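/- Let $Y_1,\dots,Y_n$ be independent multinomial vectors, $Y_r=(Y_{r1},\dots,Y_{rk})$, with ordered categories, totals $m_r\ge 1$ and category probabilities $\pi_{r1},\dots,\pi_{rk}$; put $q=k-1$. In the cumulative link model with covariates $x_r\in\mathbb R^p$, $$\gamma_{rs}=\pi_{r1}+\dots+\pi_{rs}=G(\eta_{rs}),\qquad \eta_{rs}=\alpha_s-\sum_{t=1}^p\beta_t x_{rt}=\sum_{t=1}^{p+q}\delta_t z_{rst}\qquad(1\le s\le q),$$ where $\delta=(\alpha_1,\dots,\alpha_q,\beta_1,\dots,\beta_p)$ with $\alpha_1<\dots<\alpha_q$, $z_{rst}$ is the $(s,t)$ entry of the $q\times(q+p)$ matrix $Z_r=[\,1_q \mid -\mathbf 1x_r^T\,]$, and $G:\mathbb R\to(0,1)$ is strictly increasing and twice differentiable, $g=G'$, $g'=G''$. Assume that the matrix with row blocks $Z_1,\dots,Z_n$ has full column rank $q+p$. Write $\ell(\delta;y)$ for the log-likelihood, $U_t(\delta)=\partial \ell/\partial\delta_t$ for the scores, and $F(\delta)=E_\delta[UU^T]$ for the expected information. Let $b(\delta)$ be the first-order bias of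 the maximum likelihood estimator: when the experiment is replicated $N$ times (totals $Nm_r$), the bias of the maximum likelihood estimator $\hat\delta_N$ is $b(\delta)/N+o(1/N)$. Because $\hat\delta_N$ may be infinite or fail to exist with positive probability, this means that for every $\varepsilon>0$ and every choice of $\hat\delta_N$ that maximizes the likelihood whenever a maximizer exists, $$N\,E_\delta\big[(\hat\delta_N-\delta)\,\mathbf 1\{\|\hat\delta_N-\delta\|\le\varepsilon\}\big]\to b(\delta)\qquad(N\to\infty).$$ Let $\delta$ be any parameter value. If $g(\eta_{rs})\neq0$ for all $r,s$, then $F(\delta)$ is invertible. Whenever $F(\delta)$ is invertible, $b(\delta)$ exists and is unique, and the following holds with $V_r=Z_rF^{-1}Z_r^T$, $v_{rss}$ its $s$th diagonal entry, and $$c_{r0}=c_{rk}=0,\qquad c_{rs}=\tfrac12\,m_r\,g'(\eta_{rs})\,v_{rss}\quad(1\le s\le q)$$ (all quantities evaluated at $\delta$). The bias-reducing adjustment $A=-F\,b$ has components $$A_t=\sum_{r=1}^n\sum_{s=1}^q g(\eta_{rs})\left(\frac{c_{rs}-c_{r,s-1}}{\pi_{rs}}-\frac{c_{r,s+1}-c_{rs}}{\pi_{r,s+1}}\right)z_{rst}\qquad(t=1,\dots,q+p).$$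 Moreover, for all counts $y$ with $\sum_s y_{rs}=m_r$, the log-likelihood is differentiable at $\delta$, the ordinary scores are $$U_t=\sum_{r=1}^n\sum_{s=1}^q g(\eta_{rs})\left(\frac{y_{rs}}{\pi_{rs}}-\frac{y_{r,s+1}}{\pi_{r,s+1}}\right)z_{rst},$$ and the adjusted scores are $$U_t+A_t=\sum_{r=1}^n\sum_{s=1}^q g(\eta_{rs})\left\{\frac{y_{rs}+c_{rs}-c_{r,s-1}}{\pi_{rs}}-\frac{y_{r,s+1}+c_{r,s+1}-c_{rs}}{\pi_{r,s+1}}\right\}z_{rst}.$$ That is, the adjusted scores are the ordinary scores with each count $y_{rs}$ replaced by the parameter-dependent adjusted count $y_{rs}+c_{rs}-c_{r,s-1}$. -/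

import Mathlib

open Filter Topology

namespace CumulativeLink

noncomputable section

/-- The vector `(a, f 1, …, f q, b)`, indexed by `0, …, q + 1`. -/
def withEnds {q : ℕ} (a b : ℝ) (f : Fin q → ℝ) : Fin (q + 2) → ℝ :=
  Fin.cons (α := fun _ => ℝ) a (Fin.snoc (α := fun _ => ℝ) f b)

/-- A parameter vector `(α₁, …, α_q, β₁, …, β_p)`. -/
abbrev Param (q p : ℕ) : Type := Fin q ⊕ Fin p → ℝ

/-- An array of `n` vectors of `k = q + 1` multinomial counts. -/
abbrev Counts (n q : ℕ) : Type := Fin n → Fin (q + 1) → ℕ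

/-- The parameter space: the cutpoints satisfy `α₁ < … < α_q`. -/
def paramSpace (q p : ℕ) : Set (Param q p) :=
  {δ | StrictMono fun s : Fin q => δ (Sum.inl s)}

section Model

variable {n p q : ℕ} (G : ℝ → ℝ) (x : Fin n → Fin p → ℝ)

/-- The `q × (q + p)` model matrix `Z_r = [1 | -x_rᵀ]`. -/
def designZ (r : Fin n) : Matrix (Fin q) (Fin q ⊕ Fin p) ℝ :=
  Matrix.fromCols 1 (Matrix.of fun _ j => - x r j)

/-- The matrix with row blocks `Z_1, …, Z_n`. -/
def fullZ : Matrix (Fin n × Fin q) (Fin q ⊕ Fin p) ℝ :=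
  Matrix.of fun rs t => designZ x rs.1 rs.2 t

/-- The predictors `η_{rs} = ∑ₜ z_{rst} δₜ = α_s - ∑ₜ βₜ x_{rt}`. -/
def eta (δ : Param q p) (r : Fin n) (s : Fin q) : ℝ :=
  ∑ t, designZ x r s t * δ t

/-- The cumulative probabilities `γ_{r0} = 0`, `γ_{rs} = G(η_{rs})`, `γ_{rk} = 1`. -/
def cumProb (δ : Param q p) (r : Fin n) : Fin (q + 2) → ℝ :=
  withEnds 0 1 fun s => G (eta x δ r s)

/-- The category probabilities `π_{rs} = γ_{rs} - γ_{r,s-1}`; the category written `s` in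
`{1, …, k}` is the element `s - 1` of `Fin (q + 1)`. -/
def catProb (δ : Param q p) (r : Fin n) (s : Fin (q + 1)) : ℝ :=
  cumProb G x δ r s.succ - cumProb G x δ r s.castSucc

/-- The joint probability of the counts `y` under independent multinomial vectors with category
probabilities `π_r(δ)` and totals `∑ₛ y_{rs}`. -/
def likelihood (y : Counts n q) (δ : Param q p) : ℝ :=
  ∏ r, ((Nat.multinomial Finset.univ (y r) : ℝ) * ∏ s, catProb G x δ r s ^ y r s)

/-- The multinomial log-likelihood. -/
def logLik (y : Counts n q) (δ : Param q p) : ℝ :=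
  Real.log (likelihood G x y δ)

/-- The score functions `U_t(δ) = ∂ℓ(δ)/∂δ_t`. -/
def score (y : Counts n q) (δ : Param q p) (t : Fin q ⊕ Fin p) : ℝ :=
  fderiv ℝ (logLik G x y) δ (Pi.single t 1)

/-- All arrays of counts with multinomial totals `m_1, …, m_n`. -/
def sampleSpace (q : ℕ) (m : Fin n → ℕ) : Finset (Counts n q) :=
  Fintype.piFinset fun r => Finset.piAntidiag Finset.univ (m r)

/-- `E_δ[f(Y)]` for independent `Y_r ∼ Multinomial(m_r, π_r(δ))`. -/
def expectation {V : Type*} [AddCommMonoid V] [Module ℝ V] (m : Fin n → ℕ) (δ : Param q p)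
    (f : Counts n q → V) : V :=
  ∑ y ∈ sampleSpace q m, likelihood G x y δ • f y

/-- The expected (Fisher) information matrix `F(δ) = E_δ[U(δ) U(δ)ᵀ]`. -/
def information (m : Fin n → ℕ) (δ : Param q p) :
    Matrix (Fin q ⊕ Fin p) (Fin q ⊕ Fin p) ℝ :=
  Matrix.of fun t u => expectation G x m δ fun y => score G x y δ t * score G x y δ u

/-- `T` is a maximum likelihood estimator: `T y` maximizes the likelihood over the parameter
space whenever a maximizer exists. For other `y` (estimates on the boundary) it is arbitrary. -/
def IsMLE (T : Counts n q → Param q p) : Prop :=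
  ∀ y, (∃ d ∈ paramSpace q p, IsMaxOn (logLik G x y) (paramSpace q p) d) →
    T y ∈ paramSpace q p ∧ IsMaxOn (logLik G x y) (paramSpace q p) (T y)

/-- `b` is the first-order term of the bias at `δ` of the maximum likelihood estimator: if the
experiment is replicated `N` times, so that the totals become `N m_r` and the information
`N F(δ)`, then the bias is `b / N + o(1 / N)`.
Since the estimate is on the boundary (infinite or nonexistent) with positive, exponentially small
probability, the bias is computed on the event that the estimate is within a fixed distance `ε`
of `δ`; the expansion has to hold for every `ε > 0`. -/
def IsFirstOrderBias (m : Fin n → ℕ) (δ b : Param q p) : Prop :=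
  ∀ T : Counts n q → Param q p, IsMLE G x T → ∀ ε : ℝ, 0 < ε →
    Tendsto
      (fun N : ℕ => (N : ℝ) • expectation G x (fun r => N * m r) δ
        fun y => if ‖T y - δ‖ ≤ ε then T y - δ else 0)
      atTop (𝓝 b)

/-- The adjustment functions `A = -F(δ) b`. -/
def adjustment (m : Fin n → ℕ) (δ b : Param q p) : Param q p :=
  -((information G x m δ).mulVec b)

/-- `V_r = Z_r F⁻¹ Z_rᵀ`. -/
def predVar (m : Fin n → ℕ) (δ : Param q p) (r : Fin n) : Matrix (Fin q) (Fin q) ℝ :=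
  (designZ x r : Matrix (Fin q) (Fin q ⊕ Fin p) ℝ) * (information G x m δ)⁻¹ *
    (designZ x r : Matrix (Fin q) (Fin q ⊕ Fin p) ℝ).transpose

/-- `c_{r0} = c_{rk} = 0` and `c_{rs} = ½ m_r g'(η_{rs}) v_{rss}`, with `g' = G''`. -/
def countAdj (m : Fin n → ℕ) (δ : Param q p) (r : Fin n) : Fin (q + 2) → ℝ :=
  withEnds 0 0 fun s => 1 / 2 * (m r : ℝ) * deriv (deriv G) (eta x δ r s) * predVar G x m δ r s s

/-- `∑ᵣ ∑ₛ g(η_{rs}) (a_{rs} / π_{rs} - a_{r,s+1} / π_{r,s+1}) z_{rst}` for an array `a` of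
real (pseudo-)counts, with `g = G'`. -/
def scoreForm (a : Fin n → Fin (q + 1) → ℝ) (δ : Param q p) (t : Fin q ⊕ Fin p) : ℝ :=
  ∑ r, ∑ s : Fin q, deriv G (eta x δ r s) *
    (a r s.castSucc / catProb G x δ r s.castSucc - a r s.succ / catProb G x δ r s.succ) *
      designZ x r s t

end Model

end

end CumulativeLink

open CumulativeLink

/-! Let `u` be the deviation of the averaged counts from their means, `D` the matrix of `∂ log
π_{rs}/∂δ_t`, `J` the Jacobian of the expected counts, `Σ` their covariance and `d` the estimation
error. At an interior maximizer the score equations read `∑ᵢ (uᵢ - μᵢ(d)) Φᵢₜ(d) = 0`, with `μ(d)`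
the change in the expected counts and `Φ(d)` the log-gradient at `δ + d`. Taylor expansion gives `d
= K u + F⁻¹ Q(u) + o(‖u‖²)`, where `K = F⁻¹Dᵀ` and `Q` is quadratic (`root_expansion`).

Here `E u = 0` and `N E[u uᵀ] = Σ` exactly. Since each row of probabilities sums to one, `Σ D = J`,
hence `F = Dᵀ J` (`covariance_mul_logGrad`, `information_eq`). So `K u` has covariance `F⁻¹/N` and
is uncorrelated with the residual `u - J K u`. The second derivatives of `log π` multiply only such
products and drop out of the mean of `Q`; what remains is `-½ ∑ mᵣ tr(π''_{rs} F⁻¹) D`. Because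
`π_{rs}` is a difference of values of `G`, this trace term is an increment of `c`
(`half_sum_catHess_mul`, `expectation_equationQuadratic`). Summation by parts (`scoreForm_eq`)
writes the adjustment and the score as the same linear form, in the increments of `c` and in the
counts, so adding the two modifies the counts.

Two analytic points justify taking means. A Hellinger-type inequality shows that parameters at least
as likely as `δ` are close to `δ` when `u` is small (`sq_catProb_sub_le`), so the estimate exists
and is consistent. The remainder after truncation is at most `c‖u‖² + B‖u‖⁴` for all data, with `c`
arbitrarily small; multiplied by `N`, the second moments stay bounded and the fourth are `O(1/N)`
(`abs_remainder_le`, `isFirstOrderBias`). -/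

namespace CumulativeLink

noncomputable section

/-! ### Moments of linear forms in a multinomial vector -/

section Multinomial

variable {ι : Type*} [Fintype ι] [DecidableEq ι]

/-- The multinomial weight of a vector of counts. -/
def multinomialWeight (p : ι → ℝ) (y : ι → ℕ) : ℝ :=
  (Nat.multinomial Finset.univ y : ℝ) * ∏ s, p s ^ y s

/-- The expectation of `f` under the multinomial distribution with total `M`. -/
def multinomialMean (p : ι → ℝ) (M : ℕ) (f : (ι → ℕ) → ℝ) : ℝ :=
  ∑ y ∈ Finset.piAntidiag Finset.univ M, multinomialWeight p y * f y

lemma multinomialWeight_add_single (p : ι → ℝ) (y : ι → ℕ) (s : ι) :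
    ((y s : ℝ) + 1) * multinomialWeight p (y + Pi.single s 1) =
      ((∑ i, y i : ℕ) + 1) * (p s * multinomialWeight p y) := by
  have hfac : ∏ i, ((y + Pi.single s 1 : ι → ℕ) i).factorial = (y s + 1) * ∏ i, (y i).factorial := by
    rw [← Finset.mul_prod_erase _ _ (Finset.mem_univ s),
      ← Finset.mul_prod_erase _ (fun i => (y i).factorial) (Finset.mem_univ s), ← mul_assoc]
    congr 1
    · simp [Nat.factorial_succ]
    · refine Finset.prod_congr rfl fun i hi => ?_
      simp [Finset.ne_of_mem_erase hi]
  have hpow : ∏ i, p i ^ (y + Pi.single s 1 : ι → ℕ) i = p s * ∏ i, p i ^ y i := by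
    simp only [Pi.add_apply, pow_add, Finset.prod_mul_distrib]
    rw [mul_comm]
    congr 1
    rw [Finset.prod_eq_single s] <;> simp +contextual
  have hsum : ∑ i, (y + Pi.single s 1 : ι → ℕ) i = ∑ i, y i + 1 := by
    simp [Finset.sum_add_distrib]
  have h1 := Nat.multinomial_spec Finset.univ (y + Pi.single s 1)
  have h2 := Nat.multinomial_spec Finset.univ y
  rw [hsum, Nat.factorial_succ, hfac, ← h2] at h1
  have hpos : 0 < ∏ i, (y i).factorial := Finset.prod_pos fun i _ => Nat.factorial_pos _
  have h3 : (y s + 1) * Nat.multinomial Finset.univ (y + Pi.single s 1) =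
      (∑ i, y i + 1) * Nat.multinomial Finset.univ y := by
    apply Nat.eq_of_mul_eq_mul_left hpos
    linarith
  have h4 : ((y s : ℝ) + 1) * Nat.multinomial Finset.univ (y + Pi.single s 1) =
      ((∑ i, y i : ℕ) + 1) * Nat.multinomial Finset.univ y := by exact_mod_cast h3
  rw [multinomialWeight, multinomialWeight, hpow, ← mul_assoc, h4]
  ring

lemma sum_piAntidiag_add_single (M : ℕ) (s : ι) (h : (ι → ℕ) → ℝ) (h0 : ∀ y, y s = 0 → h y = 0) :
    ∑ y ∈ Finset.piAntidiag Finset.univ M, h (y + Pi.single s 1) =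
      ∑ y ∈ Finset.piAntidiag Finset.univ (M + 1), h y := by
  refine Finset.sum_of_injOn (fun y => y + Pi.single s 1) (fun a _ b _ hab => by simpa using hab)
    (fun y hy => ?_) (fun y hy hy' => h0 y ?_) (fun _ _ => rfl)
  · simp only [Finset.mem_coe, Finset.mem_piAntidiag] at hy ⊢
    simp_all [Finset.sum_add_distrib]
  · by_contra hs
    refine hy' ⟨y - Pi.single s 1, ?_, ?_⟩
    · have hle : Pi.single s 1 ≤ y := by
        intro i
        by_cases hi : i = s
        · subst hi; simpa using Nat.one_le_iff_ne_zero.mpr hs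
        · simp [hi]
      simp only [Finset.mem_coe, Finset.mem_piAntidiag] at hy ⊢
      have : ∑ i, y i = ∑ i, (y - Pi.single s 1 : ι → ℕ) i + 1 := by
        conv_lhs => rw [← tsub_add_cancel_of_le hle]
        simp [Finset.sum_add_distrib]
      refine ⟨?_, by simp⟩
      have := hy.1.symm.trans this
      simpa using this.symm
    · ext i
      by_cases hi : i = s
      · subst hi; simp; omega
      · simp [hi]

/-- One trial is split off. Weighting by `y s` shifts the counts by one in category `s`, and the
weights `y s` add up to `M + 1`. All moments below follow from this by induction on the number of
trials. -/
lemma multinomialMean_succ (p : ι → ℝ) (M : ℕ) (f : (ι → ℕ) → ℝ) :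
    multinomialMean p (M + 1) f =
      ∑ s, p s * multinomialMean p M fun y => f (y + Pi.single s 1) := by
  have hM : (M : ℝ) + 1 ≠ 0 := by positivity
  apply mul_left_cancel₀ hM
  have h1 : ∀ s, ((M : ℝ) + 1) * (p s * multinomialMean p M fun y => f (y + Pi.single s 1)) =
      ∑ y ∈ Finset.piAntidiag Finset.univ (M + 1), (y s : ℝ) * multinomialWeight p y * f y := by
    intro s
    rw [← sum_piAntidiag_add_single M s _ (by simp +contextual), multinomialMean,
      Finset.mul_sum, Finset.mul_sum]
    refine Finset.sum_congr rfl fun y hy => ?_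
    have := multinomialWeight_add_single p y s
    rw [(Finset.mem_piAntidiag.mp hy).1] at this
    simp only [Pi.add_apply, Pi.single_eq_same, Nat.cast_add, Nat.cast_one]
    rw [this]
    ring
  rw [Finset.mul_sum, Finset.sum_congr rfl fun s _ => h1 s, Finset.sum_comm, multinomialMean,
    Finset.mul_sum]
  refine Finset.sum_congr rfl fun y hy => ?_
  rw [← Finset.sum_mul, ← Finset.sum_mul]
  have := (Finset.mem_piAntidiag.mp hy).1
  have h2 : ∑ s, (y s : ℝ) = M + 1 := by exact_mod_cast this
  rw [h2]
  ring

lemma multinomialMean_zero (p : ι → ℝ) (f : (ι → ℕ) → ℝ) : multinomialMean p 0 f = f 0 := by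
  simp [multinomialMean, multinomialWeight, Nat.multinomial]

lemma multinomialMean_add (p : ι → ℝ) (M : ℕ) (f g : (ι → ℕ) → ℝ) :
    multinomialMean p M (fun y => f y + g y) = multinomialMean p M f + multinomialMean p M g := by
  simp [multinomialMean, mul_add, Finset.sum_add_distrib]

lemma multinomialMean_const_mul (p : ι → ℝ) (M : ℕ) (c : ℝ) (f : (ι → ℕ) → ℝ) :
    multinomialMean p M (fun y => c * f y) = c * multinomialMean p M f := by
  simp only [multinomialMean, Finset.mul_sum]
  exact Finset.sum_congr rfl fun _ _ => by ring

lemma multinomialMean_one {p : ι → ℝ} (hp : ∑ s, p s = 1) (M : ℕ) :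
    multinomialMean p M (fun _ => 1) = 1 := by
  induction M with
  | zero => rw [multinomialMean_zero]
  | succ M ih => simp [multinomialMean_succ, ih, hp]

lemma multinomialMean_const {p : ι → ℝ} (hp : ∑ s, p s = 1) (M : ℕ) (c : ℝ) :
    multinomialMean p M (fun _ => c) = c := by
  simpa [multinomialMean_one hp] using multinomialMean_const_mul p M c fun _ => 1

lemma sum_mul_add_single (w : ι → ℝ) (y : ι → ℕ) (s : ι) :
    ∑ i, w i * ((y + Pi.single s 1 : ι → ℕ) i : ℕ) = ∑ i, w i * (y i : ℝ) + w s := by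
  have : ∀ i, w i * (((y + Pi.single s 1 : ι → ℕ) i : ℕ) : ℝ) =
      w i * (y i : ℝ) + if i = s then w i else 0 := by
    intro i
    by_cases hi : i = s
    · subst hi; simp; ring
    · simp [hi]
  rw [Finset.sum_congr rfl fun i _ => this i]
  simp [Finset.sum_add_distrib]

lemma multinomialMean_linear {p w : ι → ℝ} (hp : ∑ s, p s = 1) (hw : ∑ s, p s * w s = 0) (M : ℕ) :
    multinomialMean p M (fun y => ∑ i, w i * (y i : ℝ)) = 0 := by
  induction M with
  | zero => simp [multinomialMean_zero]
  | succ M ih =>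
    simp only [multinomialMean_succ, sum_mul_add_single, multinomialMean_add, ih,
      multinomialMean_const hp, zero_add, hw]

lemma multinomialMean_linear_mul_linear {p w w' : ι → ℝ} (hp : ∑ s, p s = 1)
    (hw : ∑ s, p s * w s = 0) (hw' : ∑ s, p s * w' s = 0) (M : ℕ) :
    multinomialMean p M (fun y => (∑ i, w i * (y i : ℝ)) * ∑ i, w' i * (y i : ℝ)) =
      M * ∑ s, p s * (w s * w' s) := by
  induction M with
  | zero => simp [multinomialMean_zero]
  | succ M ih =>
    have h : ∀ s, multinomialMean p M (fun y =>
        (∑ i, w i * (y i : ℝ) + w s) * (∑ i, w' i * (y i : ℝ) + w' s)) =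
        M * ∑ s, p s * (w s * w' s) + w s * w' s := by
      intro s
      have : (fun y : ι → ℕ => (∑ i, w i * (y i : ℝ) + w s) * (∑ i, w' i * (y i : ℝ) + w' s)) =
          fun y => (∑ i, w i * (y i : ℝ)) * (∑ i, w' i * (y i : ℝ)) +
            (w' s * (∑ i, w i * (y i : ℝ)) + (w s * (∑ i, w' i * (y i : ℝ)) + w s * w' s)) := by
        ext y; ring
      rw [this, multinomialMean_add, ih, multinomialMean_add, multinomialMean_const_mul,
        multinomialMean_linear hp hw, multinomialMean_add, multinomialMean_const_mul,
        multinomialMean_linear hp hw', multinomialMean_const hp]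
      ring
    simp only [multinomialMean_succ, sum_mul_add_single, h]
    simp only [mul_add, Finset.sum_add_distrib]
    rw [← Finset.sum_mul, hp]
    push_cast
    ring

lemma multinomialMean_linear_pow_four_le {p w : ι → ℝ} (hp0 : ∀ s, 0 ≤ p s) (hp : ∑ s, p s = 1)
    (hw : ∑ s, p s * w s = 0) (hw1 : ∀ s, w s ^ 2 ≤ 1) (M : ℕ) :
    multinomialMean p M (fun y => (∑ i, w i * (y i : ℝ)) ^ 4) ≤ 3 * (M : ℝ) ^ 2 := by
  have hsq : ∀ s, p s * (w s * w s) ≤ p s := fun s => by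
    nlinarith [hp0 s, hw1 s]
  have hσ : ∑ s, p s * (w s * w s) ≤ 1 := hp ▸ Finset.sum_le_sum fun s _ => hsq s
  have hσ0 : 0 ≤ ∑ s, p s * (w s * w s) :=
    Finset.sum_nonneg fun s _ => mul_nonneg (hp0 s) (mul_self_nonneg _)
  have hμ : ∑ s, p s * w s ^ 4 ≤ 1 := hp ▸ Finset.sum_le_sum fun s _ => by
    have : w s ^ 4 ≤ 1 := by nlinarith [hw1 s, sq_nonneg (w s)]
    nlinarith [hp0 s]
  set σ := ∑ s, p s * (w s * w s) with hσdef
  induction M with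
  | zero => simp [multinomialMean_zero]
  | succ M ih =>
    set μ := multinomialMean p M (fun y => (∑ i, w i * (y i : ℝ)) ^ 4) with hμdef
    set τ := multinomialMean p M (fun y => (∑ i, w i * (y i : ℝ)) ^ 3) with hτdef
    have h : ∀ s, multinomialMean p M (fun y => (∑ i, w i * (y i : ℝ) + w s) ^ 4) =
        μ + (4 * w s * τ + (6 * (w s * w s) * (M * σ) + w s ^ 4)) := by
      intro s
      have : (fun y : ι → ℕ => (∑ i, w i * (y i : ℝ) + w s) ^ 4) =
          fun y => (∑ i, w i * (y i : ℝ)) ^ 4 + ((4 * w s) * (∑ i, w i * (y i : ℝ)) ^ 3 +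
            ((6 * (w s * w s)) * ((∑ i, w i * (y i : ℝ)) * (∑ i, w i * (y i : ℝ))) +
              ((4 * w s ^ 3) * (∑ i, w i * (y i : ℝ)) + w s ^ 4))) := by
        ext y; ring
      rw [this, multinomialMean_add, multinomialMean_add, multinomialMean_const_mul,
        multinomialMean_add, multinomialMean_const_mul,
        multinomialMean_linear_mul_linear hp hw hw, multinomialMean_add,
        multinomialMean_const_mul, multinomialMean_linear hp hw, multinomialMean_const hp]
      ring
    -- The third moment `τ` is multiplied by the mean of `w`, which is zero. The increment is thus
    -- at most `6 M + 1`, below `3 (M + 1)² - 3 M²`.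
    have h2 : ∑ s, p s * (μ + (4 * w s * τ + (6 * (w s * w s) * (M * σ) + w s ^ 4))) =
        μ + 6 * (M * σ) * σ + ∑ s, p s * w s ^ 4 := by
      have : ∀ s, p s * (μ + (4 * w s * τ + (6 * (w s * w s) * (M * σ) + w s ^ 4))) =
          p s * μ + p s * w s * (4 * τ) + p s * (w s * w s) * (6 * (M * σ)) + p s * w s ^ 4 :=
        fun s => by ring
      simp only [this, Finset.sum_add_distrib, ← Finset.sum_mul, hp, hw, ← hσdef]
      ring
    simp only [multinomialMean_succ, sum_mul_add_single, h]
    rw [h2]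
    have hMσ : (M : ℝ) * σ * σ ≤ M := by
      have : σ * σ ≤ 1 := by nlinarith
      nlinarith [Nat.cast_nonneg (α := ℝ) M]
    push_cast
    nlinarith

end Multinomial

/-! ### Moments of the centered counts -/

section Moments

variable {n p q : ℕ} {G : ℝ → ℝ} {x : Fin n → Fin p → ℝ} {m : Fin n → ℕ} {δ : Param q p}

lemma expectation_congr {V : Type*} [AddCommMonoid V] [Module ℝ V] {f g : Counts n q → V}
    (h : ∀ y ∈ sampleSpace q m, f y = g y) :
    expectation G x m δ f = expectation G x m δ g :=
  Finset.sum_congr rfl fun y hy => by rw [h y hy]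

lemma expectation_add (f g : Counts n q → ℝ) :
    expectation G x m δ (fun y => f y + g y) =
      expectation G x m δ f + expectation G x m δ g := by
  simp [expectation, mul_add, Finset.sum_add_distrib]

lemma expectation_const_mul (c : ℝ) (f : Counts n q → ℝ) :
    expectation G x m δ (fun y => c * f y) = c * expectation G x m δ f := by
  simp only [expectation, Finset.mul_sum, smul_eq_mul]
  exact Finset.sum_congr rfl fun _ _ => by ring

lemma expectation_sum {κ : Type*} (S : Finset κ) (f : κ → Counts n q → ℝ) :
    expectation G x m δ (fun y => ∑ k ∈ S, f k y) = ∑ k ∈ S, expectation G x m δ (f k) := by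
  simp only [expectation, Finset.smul_sum]
  exact Finset.sum_comm

lemma expectation_apply {κ : Type*} (f : Counts n q → κ → ℝ) (t : κ) :
    expectation G x m δ f t = expectation G x m δ fun y => f y t := by
  simp [expectation, Finset.sum_apply]

lemma expectation_prod (f : Fin n → (Fin (q + 1) → ℕ) → ℝ) :
    expectation G x m δ (fun y => ∏ r, f r (y r)) =
      ∏ r, multinomialMean (catProb G x δ r) (m r) (f r) := by
  simp only [expectation, sampleSpace, multinomialMean, Finset.prod_univ_sum, likelihood,
    smul_eq_mul, ← Finset.prod_mul_distrib, multinomialWeight]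

lemma mem_sampleSpace {y : Counts n q} : y ∈ sampleSpace q m ↔ ∀ r, ∑ s, y r s = m r := by
  simp [sampleSpace, Finset.mem_piAntidiag]

lemma sum_catProb (r : Fin n) : ∑ s, catProb G x δ r s = 1 := by
  simp only [catProb, Finset.sum_sub_distrib]
  have h := Fin.sum_univ_succ (cumProb G x δ r)
  rw [Fin.sum_univ_castSucc] at h
  have h0 : cumProb G x δ r 0 = 0 := rfl
  have h1 : cumProb G x δ r (Fin.last _) = 1 := by
    simp [cumProb, withEnds, ← Fin.succ_last]
  linarith

lemma expectation_marginal (r : Fin n) (f : (Fin (q + 1) → ℕ) → ℝ) :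
    expectation G x m δ (fun y => f (y r)) =
      multinomialMean (catProb G x δ r) (m r) f := by
  have h := expectation_prod (G := G) (x := x) (m := m) (δ := δ)
    fun r' z => if r' = r then f z else 1
  simp only [Finset.prod_ite_eq', Finset.mem_univ, if_true] at h
  rw [h, Finset.prod_eq_single r]
  · simp
  · intro r' _ hr'
    simp [hr', multinomialMean_one (sum_catProb r')]
  · simp

/-- The standardized count `y_{rs} - m_r π_{rs}`. -/
def centered (G : ℝ → ℝ) (x : Fin n → Fin p → ℝ) (m : Fin n → ℕ) (δ : Param q p)
    (y : Counts n q) (i : Fin n × Fin (q + 1)) : ℝ :=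
  y i.1 i.2 - m i.1 * catProb G x δ i.1 i.2

/-- The coefficients of the centered indicator of a category. -/
def centerCoeff (π : Fin (q + 1) → ℝ) (s s' : Fin (q + 1)) : ℝ :=
  (if s' = s then 1 else 0) - π s

/-- Because the totals are fixed, the centering constant can be absorbed into the coefficients;
these have mean zero, as the multinomial moment lemmas require. -/
lemma centered_eq {y : Counts n q} (hy : y ∈ sampleSpace q m) (i : Fin n × Fin (q + 1)) :
    centered G x m δ y i = ∑ s, centerCoeff (catProb G x δ i.1) i.2 s * (y i.1 s : ℝ) := by
  have h : ∑ s, (y i.1 s : ℝ) = m i.1 := by exact_mod_cast mem_sampleSpace.mp hy i.1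
  simp [centered, centerCoeff, sub_mul, Finset.sum_sub_distrib, ← Finset.mul_sum, h]
  ring

lemma sum_mul_centerCoeff {π : Fin (q + 1) → ℝ} (hπ : ∑ s, π s = 1) (s : Fin (q + 1)) :
    ∑ s', π s' * centerCoeff π s s' = 0 := by
  simp [centerCoeff, mul_sub, Finset.sum_sub_distrib, ← Finset.sum_mul, hπ]

/-- The covariance matrix of the counts. -/
def covariance (G : ℝ → ℝ) (x : Fin n → Fin p → ℝ) (m : Fin n → ℕ) (δ : Param q p) :
    Matrix (Fin n × Fin (q + 1)) (Fin n × Fin (q + 1)) ℝ :=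
  Matrix.of fun i j => if i.1 = j.1 then
    (m i.1 : ℝ) * ((if i.2 = j.2 then catProb G x δ i.1 i.2 else 0) -
      catProb G x δ i.1 i.2 * catProb G x δ j.1 j.2) else 0

lemma expectation_centered (i : Fin n × Fin (q + 1)) :
    expectation G x m δ (fun y => centered G x m δ y i) = 0 := by
  rw [expectation_congr fun y hy => centered_eq hy i,
    expectation_marginal i.1
      fun z => ∑ s, centerCoeff (catProb G x δ i.1) i.2 s * (z s : ℝ)]
  exact multinomialMean_linear (sum_catProb _) (sum_mul_centerCoeff (sum_catProb _) _) _

lemma expectation_centered_mul (i j : Fin n × Fin (q + 1)) :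
    expectation G x m δ (fun y => centered G x m δ y i * centered G x m δ y j) =
      covariance G x m δ i j := by
  rw [expectation_congr fun y hy => by rw [centered_eq hy i, centered_eq hy j]]
  obtain ⟨r, s⟩ := i
  obtain ⟨r', s'⟩ := j
  simp only [covariance, Matrix.of_apply]
  split_ifs with hr hs
  · subst hr hs
    rw [expectation_marginal r fun z =>
      (∑ i, centerCoeff (catProb G x δ r) s i * (z i : ℝ)) *
        ∑ i, centerCoeff (catProb G x δ r) s i * (z i : ℝ),
      multinomialMean_linear_mul_linear (sum_catProb _) (sum_mul_centerCoeff (sum_catProb _) _)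
        (sum_mul_centerCoeff (sum_catProb _) _)]
    congr 1
    have h : ∀ i, catProb G x δ r i * (centerCoeff (catProb G x δ r) s i *
        centerCoeff (catProb G x δ r) s i) = (if i = s then catProb G x δ r i else 0) *
          centerCoeff (catProb G x δ r) s i - catProb G x δ r s *
            (catProb G x δ r i * centerCoeff (catProb G x δ r) s i) := by
      intro i; simp only [centerCoeff]; split_ifs <;> ring
    simp only [h, Finset.sum_sub_distrib, ← Finset.mul_sum,
      sum_mul_centerCoeff (sum_catProb _)]
    simp [centerCoeff]
    ring
  · subst hr
    rw [expectation_marginal r fun z =>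
      (∑ i, centerCoeff (catProb G x δ r) s i * (z i : ℝ)) *
        ∑ i, centerCoeff (catProb G x δ r) s' i * (z i : ℝ),
      multinomialMean_linear_mul_linear (sum_catProb _) (sum_mul_centerCoeff (sum_catProb _) _)
        (sum_mul_centerCoeff (sum_catProb _) _)]
    congr 1
    have h : ∀ i, catProb G x δ r i * (centerCoeff (catProb G x δ r) s i *
        centerCoeff (catProb G x δ r) s' i) = (if i = s then catProb G x δ r i else 0) *
          centerCoeff (catProb G x δ r) s' i - catProb G x δ r s *
            (catProb G x δ r i * centerCoeff (catProb G x δ r) s' i) := by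
      intro i; simp only [centerCoeff]; split_ifs <;> ring
    simp only [h, Finset.sum_sub_distrib, ← Finset.mul_sum,
      sum_mul_centerCoeff (sum_catProb _)]
    simp_all [centerCoeff]
  -- Different rows are independent, so the mean factors over rows and the factor of row `r`
  -- vanishes.
  · have h := expectation_prod (G := G) (x := x) (m := m) (δ := δ) fun r'' z =>
      (if r'' = r then ∑ i, centerCoeff (catProb G x δ r) s i * (z i : ℝ) else 1) *
      (if r'' = r' then ∑ i, centerCoeff (catProb G x δ r') s' i * (z i : ℝ) else 1)
    simp only [Finset.prod_mul_distrib, Finset.prod_ite_eq', Finset.mem_univ, if_true] at h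
    rw [h]
    refine Finset.prod_eq_zero (Finset.mem_univ r) ?_
    simp only [if_true, hr, if_false, mul_one]
    exact multinomialMean_linear (sum_catProb _) (sum_mul_centerCoeff (sum_catProb _) _) _

lemma expectation_centered_pow_four_le (hπ : ∀ r s, 0 ≤ catProb G x δ r s)
    (i : Fin n × Fin (q + 1)) :
    expectation G x m δ (fun y => centered G x m δ y i ^ 4) ≤ 3 * (m i.1 : ℝ) ^ 2 := by
  rw [expectation_congr fun y hy => by rw [centered_eq hy i],
    expectation_marginal i.1
      fun z => (∑ s, centerCoeff (catProb G x δ i.1) i.2 s * (z s : ℝ)) ^ 4]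
  refine multinomialMean_linear_pow_four_le (hπ _) (sum_catProb _)
    (sum_mul_centerCoeff (sum_catProb _) _) (fun s => ?_) _
  have h1 : catProb G x δ i.1 i.2 ≤ 1 := by
    rw [← sum_catProb (G := G) (x := x) (δ := δ) i.1]
    exact Finset.single_le_sum (fun s _ => hπ i.1 s) (Finset.mem_univ _)
  have h0 := hπ i.1 i.2
  simp only [centerCoeff]
  split_ifs <;> nlinarith

end Moments


/-! ### Second-order expansion of a root of an estimating equation -/

section Expansion

open Asymptotics Matrix

/-- The remainder has derivative `o(h)` by differentiability of `deriv f` at `a`, and the mean value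
inequality on the ball of radius `|h|` gains one more factor `|h|`. No continuity of the second
derivative is needed. -/
lemma isLittleO_sub_taylor_two {f : ℝ → ℝ} (hf : Differentiable ℝ f) {a : ℝ}
    (hf' : DifferentiableAt ℝ (deriv f) a) :
    (fun h => f (a + h) - f a - deriv f a * h - 1 / 2 * (deriv (deriv f) a * h ^ 2)) =o[𝓝 0]
      fun h => h ^ 2 := by
  rw [isLittleO_iff]
  intro c hc
  have h1 := isLittleO_iff.mp (hasDerivAt_iff_isLittleO_nhds_zero.mp hf'.hasDerivAt) hc
  obtain ⟨ρ, hρ, hb⟩ := Metric.eventually_nhds_iff_ball.mp h1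
  refine Metric.eventually_nhds_iff_ball.mpr ⟨ρ, hρ, fun h hh => ?_⟩
  have hd : ∀ k ∈ Metric.closedBall (0 : ℝ) |h|, HasDerivWithinAt
      (fun h => f (a + h) - f a - deriv f a * h - 1 / 2 * (deriv (deriv f) a * h ^ 2))
      (deriv f (a + k) - deriv f a - k • deriv (deriv f) a) (Metric.closedBall 0 |h|) k := by
    intro k _
    have e1 : HasDerivAt (fun h => f (a + h)) (deriv f (a + k)) k := by
      simpa using (hf (a + k)).hasDerivAt.comp_const_add a k
    have e2 := ((e1.sub_const (f a)).sub ((hasDerivAt_id k).const_mul (deriv f a))).sub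
      ((((hasDerivAt_id k).pow 2).const_mul (deriv (deriv f) a)).const_mul (1 / 2))
    refine (e2.congr_deriv ?_).hasDerivWithinAt
    simp only [id_eq, smul_eq_mul]
    norm_num
    ring
  have hbound : ∀ k ∈ Metric.closedBall (0 : ℝ) |h|,
      ‖deriv f (a + k) - deriv f a - k • deriv (deriv f) a‖ ≤ c * |h| := by
    intro k hk
    rw [mem_closedBall_zero_iff, Real.norm_eq_abs] at hk
    rw [mem_ball_zero_iff, Real.norm_eq_abs] at hh
    refine (hb k (by simpa using hk.trans_lt hh)).trans ?_
    exact mul_le_mul_of_nonneg_left hk hc.le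
  have := (convex_closedBall (0 : ℝ) |h|).norm_image_sub_le_of_norm_hasDerivWithin_le hd hbound
    (show (0 : ℝ) ∈ Metric.closedBall (0 : ℝ) |h| by simp)
    (show h ∈ Metric.closedBall (0 : ℝ) |h| by simp)
  simpa [mul_assoc, pow_two] using this

variable {α ι κ : Type*} [Fintype ι] [Fintype κ] {l : Filter α}

lemma isBigO_mulVec (M : Matrix ι κ ℝ) (v : α → κ → ℝ) : (fun a => M *ᵥ v a) =O[l] v :=
  (LinearMap.toContinuousLinearMap M.mulVecLin).isBigO_comp v l

lemma isBigO_apply (v : α → κ → ℝ) (t : κ) : (fun a => v a t) =O[l] v :=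
  isBigO_of_le l fun a => norm_le_pi_norm (v a) t

lemma isBigO_mulVec_apply (M : Matrix ι κ ℝ) (v : α → κ → ℝ) (i : ι) :
    (fun a => (M *ᵥ v a) i) =O[l] v :=
  (isBigO_apply _ i).trans (isBigO_mulVec M v)

lemma isBigO_sum_univ {f : ι → α → ℝ} {F : Type*} [SeminormedAddCommGroup F] {g : α → F}
    (h : ∀ i, f i =O[l] g) : (fun a => ∑ i, f i a) =O[l] g :=
  (IsBigO.sum fun i (_ : i ∈ Finset.univ) => h i).congr_left fun a => Finset.sum_apply a _ _

lemma isLittleO_sum_univ {f : ι → α → ℝ} {F : Type*} [SeminormedAddCommGroup F] {g : α → F}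
    (h : ∀ i, f i =o[l] g) : (fun a => ∑ i, f i a) =o[l] g :=
  (IsLittleO.sum fun i (_ : i ∈ Finset.univ) => h i).congr_left fun a => Finset.sum_apply a _ _

lemma isBigO_dotProduct_const (d : κ → ℝ) (v : α → κ → ℝ) : (fun a => d ⬝ᵥ v a) =O[l] v :=
  isBigO_sum_univ fun t => (isBigO_apply v t).const_mul_left (d t)

/-- The linear part of the expansion of a root of an estimating equation. -/
def rootLinear (S : Matrix κ κ ℝ) (D : Matrix ι κ ℝ) (u : ι → ℝ) : κ → ℝ :=
  S *ᵥ (Dᵀ *ᵥ u)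

/-- The quadratic part of an estimating equation, at the linear approximation `w` of its root. -/
def equationQuadratic (J : Matrix ι κ ℝ) (H : ι → Matrix κ κ ℝ) (D : Matrix ι κ ℝ)
    (D' : ι → κ → κ → ℝ) (u : ι → ℝ) (w : κ → ℝ) (t : κ) : ℝ :=
  ∑ i, (-(1 / 2) * (w ⬝ᵥ (H i *ᵥ w)) * D i t + (u - J *ᵥ w) i * (D' i t ⬝ᵥ w))

/-- The second-order expansion of a consistent root `v` of the estimating equation
`∑ᵢ (uᵢ - μᵢ(v)) Φᵢₜ(v) = 0`. -/
theorem root_expansion [DecidableEq κ] {u : α → ι → ℝ} {v : α → κ → ℝ} {μ : (κ → ℝ) → ι → ℝ}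
    {Φ : (κ → ℝ) → ι → κ → ℝ} {J D : Matrix ι κ ℝ} {H : ι → Matrix κ κ ℝ} {D' : ι → κ → κ → ℝ}
    {S : Matrix κ κ ℝ} (hv : Tendsto v l (𝓝 0))
    (hμ : ∀ i, (fun w => μ w i - (J *ᵥ w) i - 1 / 2 * (w ⬝ᵥ (H i *ᵥ w))) =o[𝓝 0]
      fun w => ‖w‖ ^ 2)
    (hΦ : ∀ i t, (fun w => Φ w i t - D i t - D' i t ⬝ᵥ w) =o[𝓝 0] fun w => w)
    (heq : ∀ᶠ a in l, ∀ t, ∑ i, (u a i - μ (v a) i) * Φ (v a) i t = 0)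
    (hS : S * (Dᵀ * J) = 1) :
    (fun a => v a - rootLinear S D (u a) -
      S *ᵥ equationQuadratic J H D D' (u a) (rootLinear S D (u a))) =o[l]
        fun a => ‖u a‖ ^ 2 := by
  set w : α → κ → ℝ := fun a => rootLinear S D (u a) with hw
  set e : α → ι → ℝ := fun a i => u a i - μ (v a) i with he
  have hv0 : v =o[l] fun _ => (1 : ℝ) := (isLittleO_one_iff ℝ).mpr hv
  have hvn : (fun a => ‖v a‖ ^ 2) =o[l] v := by
    have := hv0.norm_left.mul_isBigO (isBigO_refl v l).norm_norm
    simpa [pow_two] using this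
  have hquad : ∀ i, (fun a => v a ⬝ᵥ (H i *ᵥ v a)) =O[l] fun a => ‖v a‖ ^ 2 := by
    intro i
    simp only [pow_two]
    exact isBigO_sum_univ fun t => ((isBigO_apply v t).norm_right).mul
      (isBigO_mulVec_apply _ v t).norm_right
  have hμv : ∀ i, (fun a => e a i - (u a - J *ᵥ v a) i + 1 / 2 * (v a ⬝ᵥ (H i *ᵥ v a))) =o[l]
      fun a => ‖v a‖ ^ 2 := by
    intro i
    have := ((hμ i).comp_tendsto hv).neg_left
    refine this.congr_left fun a => ?_
    simp only [he, Function.comp, Pi.sub_apply]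
    ring
  have hΦv : ∀ i t, (fun a => Φ (v a) i t - D i t - D' i t ⬝ᵥ v a) =o[l] v := fun i t =>
    (hΦ i t).comp_tendsto hv
  have heJ : ∀ i, (fun a => e a i - (u a - J *ᵥ v a) i) =O[l] fun a => ‖v a‖ ^ 2 := by
    intro i
    refine ((hμv i).isBigO.sub ((hquad i).const_mul_left (1 / 2))).congr_left fun a => ?_
    ring
  -- Until `v = O(u)` is known, errors are measured against the sum of both norms.
  set N : α → ℝ := fun a => ‖u a‖ + ‖v a‖ with hN
  have huN : u =O[l] N := isBigO_of_le l fun a => by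
    rw [Real.norm_of_nonneg (by positivity)]; simp [hN]
  have hvN : v =O[l] N := isBigO_of_le l fun a => by
    rw [Real.norm_of_nonneg (by positivity)]; simp [hN]
  have hJN : ∀ i, (fun a => (u a - J *ᵥ v a) i) =O[l] N := fun i =>
    ((isBigO_apply u i).trans huN).sub ((isBigO_mulVec_apply J v i).trans hvN)
  have heN : ∀ i, (fun a => e a i) =O[l] N := by
    intro i
    refine ((((heJ i).trans hvn.isBigO).trans hvN).add (hJN i)).congr_left fun a => ?_
    ring
  have hΦD : ∀ i t, (fun a => Φ (v a) i t - D i t) =O[l] v := by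
    intro i t
    refine ((hΦv i t).isBigO.add (isBigO_dotProduct_const (D' i t) v)).congr_left fun a => ?_
    ring
  -- The linearized equation: it differs from the exact one, which vanishes, by terms of higher
  -- order.
  have hfirst : (fun a => Dᵀ *ᵥ (u a - J *ᵥ v a)) =o[l] N := by
    refine isLittleO_pi.mpr fun t => ?_
    have hsum : (fun a => -∑ i, (e a i * (Φ (v a) i t - D i t) +
        (e a i - (u a - J *ᵥ v a) i) * D i t)) =o[l] N := by
      refine (isLittleO_sum_univ fun i => IsLittleO.add ?_ ?_).neg_left
      · have := (heN i).mul_isLittleO ((hΦD i t).trans_isLittleO hv0)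
        simpa using this
      · have := ((heJ i).trans_isLittleO hvn).trans_isBigO hvN
        refine (this.const_mul_left (D i t)).congr_left fun a => by ring
    refine hsum.congr' ?_ EventuallyEq.rfl
    filter_upwards [heq] with a ha
    have h0 := ha t
    simp only [mulVec, dotProduct, transpose_apply]
    rw [← sub_eq_zero, ← h0, ← Finset.sum_neg_distrib, ← Finset.sum_sub_distrib, h0,
      ← neg_eq_zero, ← h0, ← Finset.sum_neg_distrib]
    refine Finset.sum_congr rfl fun i _ => ?_
    simp only [he]
    ring
  have hvw : ∀ a, v a - w a = -(S *ᵥ (Dᵀ *ᵥ (u a - J *ᵥ v a))) := by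
    intro a
    have : S *ᵥ (Dᵀ *ᵥ (J *ᵥ v a)) = v a := by
      rw [mulVec_mulVec, mulVec_mulVec, Matrix.mul_assoc, hS, one_mulVec]
    simp only [hw, rootLinear, mulVec_sub, this]
    abel
  have hvwN : (fun a => v a - w a) =o[l] N := by
    simp only [hvw]
    exact ((isBigO_mulVec S _).trans_isLittleO hfirst).neg_left
  have hwu : w =O[l] u := (isBigO_mulVec S _).trans (isBigO_mulVec Dᵀ u)
  have hvu : v =O[l] u := by
    obtain ⟨C, hC⟩ := hwu.bound
    -- From `‖v‖ ≤ ½(‖u‖ + ‖v‖) + C‖u‖`, the term `½‖v‖` is absorbed on the left.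
    refine IsBigO.of_bound (1 + 2 * C) ?_
    filter_upwards [hC, isLittleO_iff.mp hvwN (show (0 : ℝ) < 1 / 2 by norm_num)] with a h1 h2
    have h3 : ‖v a‖ ≤ ‖v a - w a‖ + ‖w a‖ := norm_le_norm_sub_add _ _
    rw [Real.norm_of_nonneg (by positivity)] at h2
    simp only [hN] at h2
    linarith
  have hNu : N =O[l] u := by
    refine ((isBigO_refl u l).norm_left.add hvu.norm_left)
  have hvwu : (fun a => v a - w a) =o[l] u := hvwN.trans_isBigO hNu
  have hvu2 : (fun a => ‖v a‖ ^ 2) =O[l] fun a => ‖u a‖ ^ 2 := hvu.norm_norm.pow 2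
  have mulO : ∀ {f g : α → ℝ}, f =O[l] u → g =o[l] u → (fun a => f a * g a) =o[l]
      fun a => ‖u a‖ ^ 2 := by
    intro f g hf hg
    simp only [pow_two]
    exact hf.norm_right.mul_isLittleO hg.norm_right
  have mulo : ∀ {f g : α → ℝ}, f =o[l] u → g =O[l] u → (fun a => f a * g a) =o[l]
      fun a => ‖u a‖ ^ 2 := by
    intro f g hf hg
    simp only [pow_two]
    exact hf.norm_right.mul_isBigO hg.norm_right
  have hqdiff : ∀ i, (fun a => w a ⬝ᵥ (H i *ᵥ w a) - v a ⬝ᵥ (H i *ᵥ v a)) =o[l]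
      fun a => ‖u a‖ ^ 2 := by
    intro i
    have h1 : (fun a => v a ⬝ᵥ (H i *ᵥ (v a - w a))) =o[l] fun a => ‖u a‖ ^ 2 :=
      isLittleO_sum_univ fun t => mulO ((isBigO_apply v t).trans hvu)
        ((isBigO_mulVec_apply (H i) _ t).trans_isLittleO hvwu)
    have h2 : (fun a => (v a - w a) ⬝ᵥ (H i *ᵥ w a)) =o[l] fun a => ‖u a‖ ^ 2 :=
      isLittleO_sum_univ fun t => mulo ((isBigO_apply (fun a => v a - w a) t).trans_isLittleO hvwu)
        ((isBigO_mulVec_apply (H i) _ t).trans hwu)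
    refine (h1.add h2).neg_left.congr_left fun a => ?_
    simp only [mulVec_sub, dotProduct_sub, sub_dotProduct]
    ring
  have hew : ∀ i, (fun a => e a i - (u a - J *ᵥ w a) i) =o[l] u := by
    intro i
    have h1 : (fun a => e a i - (u a - J *ᵥ v a) i) =o[l] u :=
      ((heJ i).trans_isLittleO hvn).trans_isBigO hvu
    have h2 : (fun a => (J *ᵥ (v a - w a)) i) =o[l] u :=
      (isBigO_mulVec_apply J _ i).trans_isLittleO hvwu
    refine (h1.sub h2).congr_left fun a => ?_
    simp only [mulVec_sub, Pi.sub_apply]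
    ring
  have hJw : ∀ i, (fun a => (u a - J *ᵥ w a) i) =O[l] u := fun i =>
    (isBigO_apply u i).sub ((isBigO_mulVec_apply J w i).trans hwu)
  have hsecond : (fun a => Dᵀ *ᵥ (u a - J *ᵥ v a) + equationQuadratic J H D D' (u a) (w a)) =o[l]
      fun a => ‖u a‖ ^ 2 := by
    refine isLittleO_pi.mpr fun t => ?_
    -- The exact equation minus its quadratic part, with one replacement per term: the Taylor
    -- remainder of `μ`, `v` by `w` in the Hessian form, the Taylor remainder of `Φ`, `e` by `u - J
    -- w`, and `v` by `w` in the derivative of `Φ`.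
    have hsum : (fun a => ∑ i,
        (-((e a i - (u a - J *ᵥ v a) i + 1 / 2 * (v a ⬝ᵥ (H i *ᵥ v a))) * D i t)
          - 1 / 2 * (w a ⬝ᵥ (H i *ᵥ w a) - v a ⬝ᵥ (H i *ᵥ v a)) * D i t
          - e a i * (Φ (v a) i t - D i t - D' i t ⬝ᵥ v a)
          - (e a i - (u a - J *ᵥ w a) i) * (D' i t ⬝ᵥ v a)
          - (u a - J *ᵥ w a) i * (D' i t ⬝ᵥ (v a - w a)))) =o[l] fun a => ‖u a‖ ^ 2 := by
      refine isLittleO_sum_univ fun i => IsLittleO.sub (IsLittleO.sub (IsLittleO.sub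
        (IsLittleO.sub ?_ ?_) ?_) ?_) ?_
      · refine ((((hμv i).trans_isBigO hvu2).const_mul_left (D i t)).neg_left).congr_left
          fun a => by ring
      · refine ((hqdiff i).const_mul_left (1 / 2 * D i t)).congr_left fun a => by ring
      · exact mulO ((heN i).trans hNu) ((hΦv i t).trans_isBigO hvu)
      · exact mulo (hew i) ((isBigO_dotProduct_const _ v).trans hvu)
      · exact mulO (hJw i) ((isBigO_dotProduct_const _ _).trans_isLittleO hvwu)
    refine hsum.congr' ?_ EventuallyEq.rfl
    filter_upwards [heq] with a ha
    have h0 : ∑ i, e a i * Φ (v a) i t = 0 := ha t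
    have h1 : (Dᵀ *ᵥ (u a - J *ᵥ v a) + equationQuadratic J H D D' (u a) (w a)) t =
        ∑ i, (D i t * (u a - J *ᵥ v a) i + (-(1 / 2) * (w a ⬝ᵥ (H i *ᵥ w a)) * D i t +
          (u a - J *ᵥ w a) i * (D' i t ⬝ᵥ w a))) := by
      simp only [Pi.add_apply, mulVec, equationQuadratic, Finset.sum_add_distrib]
      rfl
    rw [h1, ← sub_eq_zero, ← Finset.sum_sub_distrib, ← neg_eq_zero, ← h0,
      ← Finset.sum_neg_distrib]
    refine Finset.sum_congr rfl fun i _ => ?_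
    simp only [dotProduct_sub]
    ring
  have hfinal : ∀ a, v a - w a - S *ᵥ equationQuadratic J H D D' (u a) (w a) =
      -(S *ᵥ (Dᵀ *ᵥ (u a - J *ᵥ v a) + equationQuadratic J H D D' (u a) (w a))) := by
    intro a
    rw [hvw, mulVec_add]
    abel
  exact ((isBigO_mulVec S _).trans_isLittleO hsecond).neg_left.congr_left
    fun a => (hfinal a).symm

end Expansion


/-! ### Summation by parts and telescoping for cumulative vectors -/

section Ends

variable {q : ℕ} {a b : ℝ} {f : Fin q → ℝ}

lemma withEnds_zero : withEnds a b f 0 = a := rfl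

lemma withEnds_succ (i : Fin (q + 1)) :
    withEnds a b f i.succ = Fin.snoc (α := fun _ => ℝ) f b i := rfl

lemma withEnds_last : withEnds a b f (Fin.last _) = b := by
  rw [← Fin.succ_last, withEnds_succ, Fin.snoc_last]

lemma withEnds_mid (s : Fin q) : withEnds a b f s.succ.castSucc = f s := by
  rw [← Fin.succ_castSucc, withEnds_succ, Fin.snoc_castSucc]

lemma ends_induction {P : Fin (q + 2) → Prop} (h0 : P 0) (h1 : P (Fin.last _))
    (hs : ∀ s : Fin q, P s.succ.castSucc) (i : Fin (q + 2)) : P i := by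
  induction i using Fin.cases with
  | zero => exact h0
  | succ i =>
    induction i using Fin.lastCases with
    | last => rw [Fin.succ_last]; exact h1
    | cast s => rw [Fin.succ_castSucc]; exact hs s

lemma withEnds_lt_succ (hf : StrictMono f) (ha : ∀ s, a < f s) (hb : ∀ s, f s < b) (hab : a < b)
    (s : Fin (q + 1)) : withEnds a b f s.castSucc < withEnds a b f s.succ := by
  induction s using Fin.cases with
  | zero =>
    rw [Fin.castSucc_zero, withEnds_zero, withEnds_succ]
    induction (0 : Fin (q + 1)) using Fin.lastCases with
    | last => simpa using hab
    | cast s => simpa using ha s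
  | succ j =>
    rw [withEnds_mid, withEnds_succ]
    have hj : j.castSucc < j.succ := Fin.castSucc_lt_succ
    generalize j.succ = i at hj
    induction i using Fin.lastCases with
    | last => simpa using hb j
    | cast i => simpa using hf (Fin.castSucc_lt_castSucc_iff.mp hj)

lemma sum_mul_sub_withEnds (c : Fin (q + 1) → ℝ) :
    ∑ s : Fin (q + 1), c s * (withEnds 0 0 f s.succ - withEnds 0 0 f s.castSucc) =
      ∑ s : Fin q, (c s.castSucc - c s.succ) * f s := by
  simp only [mul_sub, Finset.sum_sub_distrib, sub_mul]
  congr 1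
  · rw [Fin.sum_univ_castSucc, Fin.succ_last, withEnds_last, mul_zero, add_zero]
    simp only [Fin.succ_castSucc, withEnds_mid]
  · rw [Fin.sum_univ_succ, Fin.castSucc_zero, withEnds_zero, mul_zero, zero_add]
    simp only [withEnds_mid]

lemma sum_sub_castSucc (W : Fin (q + 2) → ℝ) :
    ∑ s : Fin (q + 1), (W s.succ - W s.castSucc) = W (Fin.last _) - W 0 := by
  have h := Fin.sum_univ_succ W
  rw [Fin.sum_univ_castSucc] at h
  rw [Finset.sum_sub_distrib]
  linarith

/-- Telescoping up to `i`; it recovers cumulative quantities from category quantities. -/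
lemma sum_filter_sub_castSucc (W : Fin (q + 2) → ℝ) (i : Fin (q + 2)) :
    ∑ s : Fin (q + 1), (if s.castSucc < i then W s.succ - W s.castSucc else 0) = W i - W 0 := by
  induction i using Fin.induction with
  | zero => simp
  | succ j ih =>
    have h : ∀ s : Fin (q + 1),
        (if s.castSucc < j.succ then W s.succ - W s.castSucc else 0) =
          (if s.castSucc < j.castSucc then W s.succ - W s.castSucc else 0) +
            if s = j then W s.succ - W s.castSucc else 0 := by
      intro s
      rcases lt_trichotomy s j with hs | hs | hs
      · have h1 : s.castSucc < j.succ := Fin.castSucc_lt_succ_iff.mpr hs.le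
        have h2 : s.castSucc < j.castSucc := Fin.castSucc_lt_castSucc_iff.mpr hs
        simp [h1, h2, hs.ne]
      · subst hs
        simp
      · have h1 : ¬ s.castSucc < j.succ := fun h => (Fin.castSucc_lt_succ_iff.mp h).not_gt hs
        have h2 : ¬ s.castSucc < j.castSucc := fun h =>
          (Fin.castSucc_lt_castSucc_iff.mp h).not_gt hs
        simp [h1, h2, hs.ne']
    rw [Finset.sum_congr rfl fun s _ => h s, Finset.sum_add_distrib, ih]
    simp

end Ends

/-! ### Derivatives of the model, scores and information -/

section Derivatives

open Asymptotics Matrix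

variable {n p q : ℕ} {G : ℝ → ℝ} {x : Fin n → Fin p → ℝ} {m : Fin n → ℕ} {δ : Param q p}

lemma eta_eq (δ : Param q p) (r : Fin n) (s : Fin q) :
    eta x δ r s = δ (Sum.inl s) + ∑ j, -x r j * δ (Sum.inr j) := by
  simp [eta, designZ, Matrix.one_apply]

lemma eta_add (δ w : Param q p) (r : Fin n) (s : Fin q) :
    eta x (δ + w) r s = eta x δ r s + eta x w r s := by
  simp [eta, mul_add, Finset.sum_add_distrib]

lemma catProb_pos (hG : StrictMono G) (hG' : ∀ u, G u ∈ Set.Ioo (0 : ℝ) 1)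
    (hδ : δ ∈ paramSpace q p) (r : Fin n) (s : Fin (q + 1)) : 0 < catProb G x δ r s := by
  rw [catProb, sub_pos]
  refine withEnds_lt_succ (fun i j hij => hG ?_) (fun s => (hG' _).1) (fun s => (hG' _).2)
    one_pos s
  rw [eta_eq, eta_eq]
  have : δ (Sum.inl i) < δ (Sum.inl j) := hδ hij
  linarith

lemma isOpen_paramSpace : IsOpen (paramSpace q p) := by
  simp only [paramSpace, StrictMono, Set.ofPred_forall]
  refine isOpen_iInter_of_finite fun i => isOpen_iInter_of_finite fun j =>
    isOpen_iInter_of_finite fun _ => isOpen_lt (continuous_apply _) (continuous_apply _)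

variable (G x)

/-- The gradient `∂γ_{ri}/∂δ_t` of the cumulative probabilities. -/
def cumGrad (δ : Param q p) (r : Fin n) (t : Fin q ⊕ Fin p) : Fin (q + 2) → ℝ :=
  withEnds 0 0 fun s => deriv G (eta x δ r s) * designZ x r s t

/-- The Jacobian `∂π_{rs}/∂δ_t` of the category probabilities. -/
def catGrad (δ : Param q p) : Matrix (Fin n × Fin (q + 1)) (Fin q ⊕ Fin p) ℝ :=
  Matrix.of fun i t => cumGrad G x δ i.1 t i.2.succ - cumGrad G x δ i.1 t i.2.castSucc

/-- The Hessian of the cumulative probabilities. -/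
def cumHess (δ : Param q p) (r : Fin n) (t t' : Fin q ⊕ Fin p) : Fin (q + 2) → ℝ :=
  withEnds 0 0 fun s => deriv (deriv G) (eta x δ r s) * (designZ x r s t * designZ x r s t')

/-- The Hessian of the category probabilities. -/
def catHess (δ : Param q p) (i : Fin n × Fin (q + 1)) :
    Matrix (Fin q ⊕ Fin p) (Fin q ⊕ Fin p) ℝ :=
  Matrix.of fun t t' => cumHess G x δ i.1 t t' i.2.succ - cumHess G x δ i.1 t t' i.2.castSucc

/-- The Jacobian `∂ log π_{rs}/∂δ_t`. -/
def logGrad (δ : Param q p) : Matrix (Fin n × Fin (q + 1)) (Fin q ⊕ Fin p) ℝ :=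
  Matrix.of fun i t => catGrad G x δ i t / catProb G x δ i.1 i.2

variable {G x}

lemma hasFDerivAt_eta (δ : Param q p) (r : Fin n) (s : Fin q) :
    HasFDerivAt (fun d => eta x d r s)
      (∑ t, designZ x r s t • ContinuousLinearMap.proj (R := ℝ) (φ := fun _ => ℝ) t) δ := by
  refine HasFDerivAt.congr_of_eventuallyEq (ContinuousLinearMap.hasFDerivAt
    (∑ t, designZ x r s t • ContinuousLinearMap.proj (R := ℝ) (φ := fun _ => ℝ) t)) ?_
  exact Eventually.of_forall fun d => by simp [eta]

lemma hasFDerivAt_cumProb (hG : Differentiable ℝ G) (δ : Param q p) (r : Fin n)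
    (i : Fin (q + 2)) :
    HasFDerivAt (fun d => cumProb G x d r i)
      (∑ t, cumGrad G x δ r t i • ContinuousLinearMap.proj (R := ℝ) (φ := fun _ => ℝ) t) δ := by
  induction i using ends_induction with
  | h0 => simpa [cumProb, cumGrad, withEnds_zero] using hasFDerivAt_const (0 : ℝ) δ
  | h1 => simpa [cumProb, cumGrad, withEnds_last] using hasFDerivAt_const (1 : ℝ) δ
  | hs s =>
    simp only [cumProb, cumGrad, withEnds_mid]
    refine ((hG _).hasDerivAt.comp_hasFDerivAt δ (hasFDerivAt_eta δ r s)).congr_fderiv ?_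
    simp [Finset.smul_sum, smul_smul]

lemma hasFDerivAt_catProb (hG : Differentiable ℝ G) (δ : Param q p)
    (i : Fin n × Fin (q + 1)) :
    HasFDerivAt (fun d => catProb G x d i.1 i.2)
      (∑ t, catGrad G x δ i t • ContinuousLinearMap.proj (R := ℝ) (φ := fun _ => ℝ) t) δ := by
  refine ((hasFDerivAt_cumProb hG δ i.1 i.2.succ).sub
    (hasFDerivAt_cumProb hG δ i.1 i.2.castSucc)).congr_fderiv ?_
  ext w
  simp only [catGrad, of_apply, _root_.sub_apply, _root_.sum_apply, _root_.smul_apply, smul_eq_mul,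
    sub_mul, Finset.sum_sub_distrib]

lemma differentiableAt_catGrad (hG : Differentiable ℝ (deriv G)) (δ : Param q p)
    (i : Fin n × Fin (q + 1)) (t : Fin q ⊕ Fin p) :
    DifferentiableAt ℝ (fun d => catGrad G x d i t) δ := by
  have h : ∀ j, DifferentiableAt ℝ (fun d => cumGrad G x d i.1 t j) δ := by
    intro j
    induction j using ends_induction with
    | h0 => simp [cumGrad, withEnds_zero]
    | h1 => simp [cumGrad, withEnds_last]
    | hs s =>
      simp only [cumGrad, withEnds_mid]
      exact ((hG _).comp δ (hasFDerivAt_eta δ i.1 s).differentiableAt).mul_const _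
  exact (h _).sub (h _)

lemma differentiableAt_logGrad (hG : Differentiable ℝ G) (hG' : Differentiable ℝ (deriv G))
    {i : Fin n × Fin (q + 1)} (hπ : catProb G x δ i.1 i.2 ≠ 0) (t : Fin q ⊕ Fin p) :
    DifferentiableAt ℝ (fun d => logGrad G x d i t) δ := by
  simp only [logGrad, of_apply, div_eq_mul_inv]
  exact (differentiableAt_catGrad hG' δ i t).mul
    ((hasFDerivAt_catProb hG δ i).differentiableAt.inv hπ)

lemma isLittleO_logGrad (hG : Differentiable ℝ G) (hG' : Differentiable ℝ (deriv G))
    {i : Fin n × Fin (q + 1)} (hπ : catProb G x δ i.1 i.2 ≠ 0) (t : Fin q ⊕ Fin p) :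
    (fun w => logGrad G x (δ + w) i t - logGrad G x δ i t -
      (fun t' => fderiv ℝ (fun d => logGrad G x d i t) δ (Pi.single t' 1)) ⬝ᵥ w) =o[𝓝 0]
        fun w => w := by
  have h := hasFDerivAt_iff_isLittleO_nhds_zero.mp
    (differentiableAt_logGrad hG hG' hπ t).hasFDerivAt
  refine h.congr_left fun w => ?_
  congr 1
  conv_lhs => rw [pi_eq_sum_univ' w, map_sum]
  exact Finset.sum_congr rfl fun t _ => by rw [map_smul, smul_eq_mul, mul_comm]

lemma isLittleO_cumProb (hG : Differentiable ℝ G) (hG' : Differentiable ℝ (deriv G))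
    (δ : Param q p) (r : Fin n) (i : Fin (q + 2)) :
    (fun w => cumProb G x (δ + w) r i - cumProb G x δ r i - (∑ t, cumGrad G x δ r t i * w t) -
      1 / 2 * ∑ t, w t * ∑ t', cumHess G x δ r t t' i * w t') =o[𝓝 0] fun w => ‖w‖ ^ 2 := by
  induction i using ends_induction with
  | h0 => simp [cumProb, cumGrad, cumHess, withEnds_zero]
  | h1 => simp [cumProb, cumGrad, cumHess, withEnds_last]
  | hs s =>
    have hO : (fun w : Param q p => eta x w r s) =O[𝓝 0] fun w => w :=
      isBigO_dotProduct_const (designZ x r s) fun w => w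
    have h0 : Tendsto (fun w : Param q p => eta x w r s) (𝓝 0) (𝓝 0) :=
      hO.trans_tendsto tendsto_id
    refine (((isLittleO_sub_taylor_two hG (hG' (eta x δ r s))).comp_tendsto h0).trans_isBigO
      (hO.norm_right.pow 2)).congr_left fun w => ?_
    simp only [Function.comp, cumProb, cumGrad, cumHess, withEnds_mid, eta_add]
    have h1 : ∑ t, deriv G (eta x δ r s) * designZ x r s t * w t =
        deriv G (eta x δ r s) * eta x w r s := by
      simp only [eta, Finset.mul_sum, mul_assoc]
    have h2 : ∑ t, w t * ∑ t', deriv (deriv G) (eta x δ r s) *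
        (designZ x r s t * designZ x r s t') * w t' =
          deriv (deriv G) (eta x δ r s) * eta x w r s ^ 2 := by
      have h3 : ∀ t, w t * ∑ t', deriv (deriv G) (eta x δ r s) *
          (designZ x r s t * designZ x r s t') * w t' =
            designZ x r s t * w t * (deriv (deriv G) (eta x δ r s) * eta x w r s) := by
        intro t
        simp only [eta, Finset.mul_sum]
        exact Finset.sum_congr rfl fun _ _ => by ring
      rw [Finset.sum_congr rfl fun t _ => h3 t, ← Finset.sum_mul, ← eta]
      ring
    rw [h1, h2]

lemma isLittleO_catProb (hG : Differentiable ℝ G) (hG' : Differentiable ℝ (deriv G))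
    (δ : Param q p) (i : Fin n × Fin (q + 1)) :
    (fun w => catProb G x (δ + w) i.1 i.2 - catProb G x δ i.1 i.2 - (catGrad G x δ *ᵥ w) i -
      1 / 2 * (w ⬝ᵥ (catHess G x δ i *ᵥ w))) =o[𝓝 0] fun w => ‖w‖ ^ 2 := by
  refine ((isLittleO_cumProb (x := x) hG hG' δ i.1 i.2.succ).sub
    (isLittleO_cumProb (x := x) hG hG' δ i.1 i.2.castSucc)).congr_left fun w => ?_
  simp only [catProb, mulVec, dotProduct, catGrad, catHess, of_apply, sub_mul,
    Finset.sum_sub_distrib, mul_sub]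
  ring

lemma sum_catGrad (δ : Param q p) (r : Fin n) (t : Fin q ⊕ Fin p) :
    ∑ s, catGrad G x δ (r, s) t = 0 := by
  simp only [catGrad, of_apply, sum_sub_castSucc, cumGrad, withEnds_last, withEnds_zero, sub_zero]

/-- Summation by parts moves the differences from `a / π` to the gradient of the cumulative
probabilities, whose end values are zero. -/
lemma scoreForm_eq (a : Fin n → Fin (q + 1) → ℝ) (δ : Param q p) (t : Fin q ⊕ Fin p) :
    scoreForm G x a δ t = ∑ i : Fin n × Fin (q + 1), a i.1 i.2 * logGrad G x δ i t := by
  rw [Fintype.sum_prod_type]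
  refine Finset.sum_congr rfl fun r _ => ?_
  have h := sum_mul_sub_withEnds (f := fun s => deriv G (eta x δ r s) * designZ x r s t)
    fun s => a r s / catProb G x δ r s
  calc _ = ∑ s : Fin q, (a r s.castSucc / catProb G x δ r s.castSucc -
        a r s.succ / catProb G x δ r s.succ) * (deriv G (eta x δ r s) * designZ x r s t) :=
      Finset.sum_congr rfl fun s _ => by ring
    _ = _ := by
      rw [← h]
      refine Finset.sum_congr rfl fun s _ => ?_
      simp only [logGrad, catGrad, cumGrad, of_apply]
      ring

lemma likelihood_pos (hπ : ∀ r s, 0 < catProb G x δ r s) (y : Counts n q) :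
    0 < likelihood G x y δ :=
  Finset.prod_pos fun r _ => mul_pos (by exact_mod_cast Nat.multinomial_pos _ _)
    (Finset.prod_pos fun s _ => pow_pos (hπ r s) _)

lemma logLik_eq (hπ : ∀ r s, 0 < catProb G x δ r s) (y : Counts n q) :
    logLik G x y δ = ∑ r, Real.log (Nat.multinomial Finset.univ (y r)) +
      ∑ i : Fin n × Fin (q + 1), (y i.1 i.2 : ℝ) * Real.log (catProb G x δ i.1 i.2) := by
  have h1 : ∀ r, (Nat.multinomial Finset.univ (y r) : ℝ) ≠ 0 := fun r => by
    exact_mod_cast (Nat.multinomial_pos _ _).ne'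
  have h2 : ∀ r, ∏ s, catProb G x δ r s ^ y r s ≠ 0 := fun r =>
    Finset.prod_ne_zero_iff.mpr fun s _ => pow_ne_zero _ (hπ r s).ne'
  rw [logLik, likelihood, Real.log_prod fun r _ => mul_ne_zero (h1 r) (h2 r),
    Fintype.sum_prod_type, ← Finset.sum_add_distrib]
  refine Finset.sum_congr rfl fun r _ => ?_
  rw [Real.log_mul (h1 r) (h2 r), Real.log_prod fun s _ => pow_ne_zero _ (hπ r s).ne']
  simp only [Real.log_pow]

lemma hasFDerivAt_logLik (hG_mono : StrictMono G) (hG_range : ∀ u, G u ∈ Set.Ioo (0 : ℝ) 1)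
    (hG : Differentiable ℝ G) (hδ : δ ∈ paramSpace q p) (y : Counts n q) :
    HasFDerivAt (logLik G x y) (∑ i : Fin n × Fin (q + 1), (y i.1 i.2 : ℝ) •
      ((catProb G x δ i.1 i.2)⁻¹ •
        ∑ t, catGrad G x δ i t • ContinuousLinearMap.proj (R := ℝ) (φ := fun _ => ℝ) t)) δ := by
  have h1 : HasFDerivAt (fun d => ∑ r, Real.log (Nat.multinomial Finset.univ (y r)) +
      ∑ i : Fin n × Fin (q + 1), (y i.1 i.2 : ℝ) * Real.log (catProb G x d i.1 i.2)) _ δ :=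
    (HasFDerivAt.fun_sum fun i (_ : i ∈ Finset.univ) =>
      ((hasFDerivAt_catProb hG δ i).log
        (catProb_pos hG_mono hG_range hδ i.1 i.2).ne').const_mul (y i.1 i.2 : ℝ)).const_add _
  refine h1.congr_of_eventuallyEq ?_
  filter_upwards [isOpen_paramSpace.mem_nhds hδ] with d hd
  exact logLik_eq (fun r s => catProb_pos hG_mono hG_range hd r s) y

lemma score_eq (hG_mono : StrictMono G) (hG_range : ∀ u, G u ∈ Set.Ioo (0 : ℝ) 1)
    (hG : Differentiable ℝ G) (hδ : δ ∈ paramSpace q p) (y : Counts n q) (t : Fin q ⊕ Fin p) :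
    score G x y δ t = ∑ i : Fin n × Fin (q + 1), (y i.1 i.2 : ℝ) * logGrad G x δ i t := by
  rw [score, (hasFDerivAt_logLik hG_mono hG_range hG hδ y).fderiv]
  simp only [_root_.sum_apply, _root_.smul_apply,
    ContinuousLinearMap.proj_apply, smul_eq_mul]
  refine Finset.sum_congr rfl fun i _ => ?_
  simp [logGrad, Pi.single_apply, div_eq_inv_mul]

lemma sum_mul_catProb_mul_logGrad (hπ : ∀ r s, catProb G x δ r s ≠ 0) (c : Fin n → ℝ)
    (t : Fin q ⊕ Fin p) :
    ∑ i : Fin n × Fin (q + 1), c i.1 * catProb G x δ i.1 i.2 * logGrad G x δ i t = 0 := by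
  rw [Fintype.sum_prod_type]
  refine Finset.sum_eq_zero fun r _ => ?_
  have h : ∀ s, c r * catProb G x δ r s * logGrad G x δ (r, s) t =
      c r * catGrad G x δ (r, s) t := by
    intro s
    rw [logGrad, of_apply, mul_assoc, mul_div_cancel₀ _ (hπ r s)]
  simp only [h, ← Finset.mul_sum, sum_catGrad, mul_zero]

variable (G x m)

/-- The Jacobian of the expected counts. -/
def meanGrad (δ : Param q p) : Matrix (Fin n × Fin (q + 1)) (Fin q ⊕ Fin p) ℝ :=
  Matrix.of fun i t => (m i.1 : ℝ) * catGrad G x δ i t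

variable {G x m}

/-- Each diagonal block is `mᵣ (diag π - π πᵀ)`. The diagonal part turns `∂ log π` into `∂π`; the
rank-one part vanishes because the category gradients of a row sum to zero. -/
lemma covariance_mul_logGrad (hπ : ∀ r s, catProb G x δ r s ≠ 0) :
    covariance G x m δ * logGrad G x δ = meanGrad G x m δ := by
  ext ⟨r, s⟩ t
  have h := sum_mul_catProb_mul_logGrad hπ (fun r' => if r = r' then 1 else 0) t
  have h2 : ∀ j : Fin n × Fin (q + 1), covariance G x m δ (r, s) j * logGrad G x δ j t =
      (if (r, s) = j then (m r : ℝ) * catGrad G x δ j t else 0) - m r * catProb G x δ r s *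
        ((if r = j.1 then 1 else 0) * catProb G x δ j.1 j.2 * logGrad G x δ j t) := by
    rintro ⟨r', s'⟩
    simp only [covariance, of_apply, Prod.mk.injEq]
    by_cases hr : r = r'
    · subst hr
      by_cases hs : s = s'
      · subst hs
        simp only [logGrad, of_apply, and_self, if_true]
        field_simp [hπ r s]
      · simp only [hs, and_false, if_true, if_false]
        ring
    · simp [hr]
  rw [mul_apply, Finset.sum_congr rfl fun j _ => h2 j, Finset.sum_sub_distrib, ← Finset.mul_sum, h]
  simp [meanGrad]

lemma score_eq_centered (hG_mono : StrictMono G) (hG_range : ∀ u, G u ∈ Set.Ioo (0 : ℝ) 1)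
    (hG : Differentiable ℝ G) (hδ : δ ∈ paramSpace q p) (y : Counts n q) (t : Fin q ⊕ Fin p) :
    score G x y δ t = ∑ i, centered G x m δ y i * logGrad G x δ i t := by
  simp only [centered, sub_mul, Finset.sum_sub_distrib]
  rw [sum_mul_catProb_mul_logGrad (fun r s => (catProb_pos hG_mono hG_range hδ r s).ne')
    fun r => (m r : ℝ), sub_zero, score_eq hG_mono hG_range hG hδ]

lemma information_eq (hG_mono : StrictMono G) (hG_range : ∀ u, G u ∈ Set.Ioo (0 : ℝ) 1)
    (hG : Differentiable ℝ G) (hδ : δ ∈ paramSpace q p) :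
    information G x m δ = (logGrad G x δ)ᵀ * meanGrad G x m δ := by
  ext t t'
  rw [← covariance_mul_logGrad fun r s => (catProb_pos hG_mono hG_range hδ r s).ne', information,
    of_apply]
  simp only [score_eq_centered (m := m) hG_mono hG_range hG hδ, Finset.sum_mul_sum,
    expectation_sum]
  simp only [mul_apply, transpose_apply, Finset.mul_sum]
  refine Finset.sum_congr rfl fun i _ => Finset.sum_congr rfl fun j _ => ?_
  have h : (fun y => centered G x m δ y i * logGrad G x δ i t *
      (centered G x m δ y j * logGrad G x δ j t')) = fun y => logGrad G x δ i t *
        logGrad G x δ j t' * (centered G x m δ y i * centered G x m δ y j) := by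
    ext y
    ring
  rw [h, expectation_const_mul, expectation_centered_mul]
  ring

lemma isSymm_information : (information G x m δ).IsSymm := by
  ext t t'
  simp [information, mul_comm]

lemma mulVec_fullZ_injective (hZ : (fullZ (q := q) x).rank = q + p) :
    Function.Injective (fullZ (q := q) x).mulVec := by
  rw [Matrix.mulVec_injective_iff, linearIndependent_iff_card_eq_finrank_span, Set.finrank,
    ← Matrix.rank_eq_finrank_span_cols, hZ]
  simp

lemma fullZ_mulVec (w : Param q p) (i : Fin n × Fin q) :
    (fullZ x *ᵥ w) i = eta x w i.1 i.2 := rfl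

/-- The quadratic form of `F` is `∑ (mᵣ / π_{rs}) (∂π_{rs}·w)²`. On the kernel every category
derivative along `w` vanishes, hence by telescoping every cumulative one `g(η_{rs}) (Zᵣ w)_s`; with
`g ≠ 0` and full column rank, `w = 0`. -/
lemma isUnit_information (hG_mono : StrictMono G) (hG_range : ∀ u, G u ∈ Set.Ioo (0 : ℝ) 1)
    (hG : Differentiable ℝ G) (hδ : δ ∈ paramSpace q p) (hm : ∀ r, 0 < m r)
    (hZ : (fullZ (q := q) x).rank = q + p) (hg : ∀ r s, deriv G (eta x δ r s) ≠ 0) :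
    IsUnit (information G x m δ) := by
  rw [← Matrix.mulVec_injective_iff_isUnit]
  refine (injective_iff_map_eq_zero (information G x m δ).mulVecLin).mpr fun w hw => ?_
  rw [mulVecLin_apply, information_eq hG_mono hG_range hG hδ] at hw
  have hπ := fun r s => catProb_pos (x := x) hG_mono hG_range hδ r s
  have h0 : ∑ i : Fin n × Fin (q + 1), (m i.1 : ℝ) / catProb G x δ i.1 i.2 *
      (catGrad G x δ *ᵥ w) i ^ 2 = 0 := by
    have h1 : w ⬝ᵥ (((logGrad G x δ)ᵀ * meanGrad G x m δ) *ᵥ w) = 0 := by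
      rw [hw, dotProduct_zero]
    rw [← mulVec_mulVec, dotProduct_mulVec, vecMul_transpose] at h1
    rw [← h1]
    refine Finset.sum_congr rfl fun i _ => ?_
    have h2 : (logGrad G x δ *ᵥ w) i = (catGrad G x δ *ᵥ w) i / catProb G x δ i.1 i.2 := by
      simp only [mulVec, dotProduct, logGrad, of_apply, Finset.sum_div]
      exact Finset.sum_congr rfl fun _ _ => by ring
    have h3 : (meanGrad G x m δ *ᵥ w) i = m i.1 * (catGrad G x δ *ᵥ w) i := by
      simp only [mulVec, dotProduct, meanGrad, of_apply, Finset.mul_sum, mul_assoc]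
    rw [h2, h3]
    ring
  have h4 : ∀ r s, (catGrad G x δ *ᵥ w) (r, s) = 0 := by
    intro r s
    have hc : 0 < (m r : ℝ) / catProb G x δ r s := div_pos (by exact_mod_cast hm r) (hπ r s)
    have := (Finset.sum_eq_zero_iff_of_nonneg fun (i : Fin n × Fin (q + 1)) _ =>
      mul_nonneg (div_pos (Nat.cast_pos.mpr (hm i.1)) (hπ i.1 i.2)).le
        (sq_nonneg ((catGrad G x δ *ᵥ w) i))).mp h0 (r, s) (Finset.mem_univ _)
    simpa [hc.ne'] using this
  have h5 : ∀ r j, ∑ t, cumGrad G x δ r t j * w t = 0 := by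
    intro r j
    have h6 := sum_filter_sub_castSucc (fun j => ∑ t, cumGrad G x δ r t j * w t) j
    have h7 : ∀ s : Fin (q + 1), ∑ t, cumGrad G x δ r t s.succ * w t -
        ∑ t, cumGrad G x δ r t s.castSucc * w t = 0 := by
      intro s
      rw [← h4 r s]
      simp only [mulVec, dotProduct, catGrad, of_apply, sub_mul, Finset.sum_sub_distrib]
    simp only [h7, ite_self, Finset.sum_const_zero] at h6
    simpa [cumGrad, withEnds_zero] using h6.symm
  apply mulVec_fullZ_injective hZ
  ext ⟨r, s⟩
  have h8 := h5 r s.succ.castSucc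
  simp only [cumGrad, withEnds_mid, mul_assoc, ← Finset.mul_sum] at h8
  simpa [fullZ_mulVec, eta] using (mul_eq_zero.mp h8).resolve_left (hg r s)

/-- The Hessian of `G(η_{rs})` is `g'(η_{rs})` times the rank-one matrix of row `s` of `Zᵣ`, so its
contraction with `F⁻¹` is `g'(η_{rs}) v_{rss}`. This is where `c` originates. -/
lemma half_sum_catHess_mul (i : Fin n × Fin (q + 1)) :
    1 / 2 * (m i.1 : ℝ) * ∑ t, ∑ t', catHess G x δ i t t' * (information G x m δ)⁻¹ t t' =
      countAdj G x m δ i.1 i.2.succ - countAdj G x m δ i.1 i.2.castSucc := by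
  have h : ∀ j, 1 / 2 * (m i.1 : ℝ) *
      ∑ t, ∑ t', cumHess G x δ i.1 t t' j * (information G x m δ)⁻¹ t t' =
        countAdj G x m δ i.1 j := by
    intro j
    induction j using ends_induction with
    | h0 => simp [cumHess, countAdj, withEnds_zero]
    | h1 => simp [cumHess, countAdj, withEnds_last]
    | hs s =>
      simp only [cumHess, countAdj, withEnds_mid, predVar, mul_apply, transpose_apply,
        Finset.sum_mul, Finset.mul_sum]
      rw [Finset.sum_comm]
      exact Finset.sum_congr rfl fun t' _ => Finset.sum_congr rfl fun t _ => by ring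
  rw [← h, ← h]
  simp only [catHess, of_apply, sub_mul, Finset.sum_sub_distrib, mul_sub]

end Derivatives


/-! ### Consistency and expansion of the maximum likelihood estimator -/

section Consistency

open Asymptotics Matrix

variable {n p q : ℕ} {G : ℝ → ℝ} {x : Fin n → Fin p → ℝ} {m : Fin n → ℕ} {δ : Param q p}

/-- The deviation `y_{rs} / N - m_r π_{rs}` of the averaged counts of `N` replications. -/
def meanDeviation (G : ℝ → ℝ) (x : Fin n → Fin p → ℝ) (m : Fin n → ℕ) (δ : Param q p)
    (a : ℕ × Counts n q) (i : Fin n × Fin (q + 1)) : ℝ :=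
  (a.1 : ℝ)⁻¹ * centered G x (fun r => a.1 * m r) δ a.2 i

/-- The possible outcomes of replicated experiments. -/
def replications (q : ℕ) (m : Fin n → ℕ) : Set (ℕ × Counts n q) :=
  {a | 0 < a.1 ∧ a.2 ∈ sampleSpace q fun r => a.1 * m r}

lemma count_eq {a : ℕ × Counts n q} (ha : 0 < a.1) (i : Fin n × Fin (q + 1)) :
    (a.2 i.1 i.2 : ℝ) = a.1 * (m i.1 * catProb G x δ i.1 i.2 + meanDeviation G x m δ a i) := by
  have h : (a.1 : ℝ) ≠ 0 := by positivity
  rw [meanDeviation, centered, mul_add, mul_inv_cancel_left₀ h]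
  push_cast
  ring

lemma catProb_le_one (hπ : ∀ r s, 0 < catProb G x δ r s) (r : Fin n) (s : Fin (q + 1)) :
    catProb G x δ r s ≤ 1 := by
  rw [← sum_catProb (G := G) (x := x) (δ := δ) r]
  exact Finset.single_le_sum (fun s _ => (hπ r s).le) (Finset.mem_univ s)

/-- Parameters at least as likely as `δ` have category probabilities close to those at `δ`. -/
lemma sq_catProb_sub_le (hm : ∀ r, 0 < m r) (hπ : ∀ r s, 0 < catProb G x δ r s) {d : Param q p}
    (hd : ∀ r s, 0 < catProb G x d r s) {a : ℕ × Counts n q} (ha : a ∈ replications q m)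
    (hle : logLik G x a.2 δ ≤ logLik G x a.2 d) (i : Fin n × Fin (q + 1)) :
    (catProb G x d i.1 i.2 - catProb G x δ i.1 i.2) ^ 2 ≤
      8 * (∑ j : Fin n × Fin (q + 1), (1 + (catProb G x δ j.1 j.2)⁻¹)) *
        ‖meanDeviation G x m δ a‖ := by
  set π : Fin n × Fin (q + 1) → ℝ := fun j => catProb G x δ j.1 j.2 with hπdef
  set π' : Fin n × Fin (q + 1) → ℝ := fun j => catProb G x d j.1 j.2 with hπ'def
  set u := meanDeviation G x m δ a with hu
  have hπ0 : ∀ j, 0 < π j := fun j => hπ j.1 j.2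
  have hπ'0 : ∀ j, 0 < π' j := fun j => hd j.1 j.2
  have hπ1 : ∀ j, π j ≤ 1 := fun j => catProb_le_one hπ _ _
  have hπ'1 : ∀ j, π' j ≤ 1 := fun j => catProb_le_one hd _ _
  obtain ⟨hN, -⟩ := ha
  have hN' : (0 : ℝ) < a.1 := by exact_mod_cast hN
  -- Using `log z ≤ 2(√z - 1)` bounds the log-likelihood ratio by a Hellinger distance and avoids
  -- logarithms of probabilities `π'` near zero.
  set h : Fin n × Fin (q + 1) → ℝ := fun j => √(π' j / π j) with hh
  have hh0 : ∀ j, 0 < h j := fun j => Real.sqrt_pos.mpr (div_pos (hπ'0 j) (hπ0 j))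
  have hhsq : ∀ j, π j * h j ^ 2 = π' j := fun j => by
    rw [hh, Real.sq_sqrt (div_pos (hπ'0 j) (hπ0 j)).le, mul_div_cancel₀ _ (hπ0 j).ne']
  have hlog : ∀ j, Real.log (π' j) - Real.log (π j) ≤ 2 * (h j - 1) := by
    intro j
    have h1 := Real.log_le_sub_one_of_pos (hh0 j)
    rw [hh, Real.log_sqrt (div_pos (hπ'0 j) (hπ0 j)).le,
      Real.log_div (hπ'0 j).ne' (hπ0 j).ne'] at h1
    simp only [hh]
    linarith
  have h1 : 0 ≤ ∑ j, ((m j.1 : ℝ) * π j + u j) * (h j - 1) := by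
    rw [logLik_eq hπ, logLik_eq hd, add_le_add_iff_left] at hle
    have h2 : 0 ≤ ∑ j : Fin n × Fin (q + 1),
        (a.2 j.1 j.2 : ℝ) * (Real.log (π' j) - Real.log (π j)) := by
      simp only [mul_sub, Finset.sum_sub_distrib]
      exact sub_nonneg.mpr hle
    have h3 : ∑ j : Fin n × Fin (q + 1), (a.2 j.1 j.2 : ℝ) * (Real.log (π' j) - Real.log (π j)) ≤
        ∑ j : Fin n × Fin (q + 1), (a.2 j.1 j.2 : ℝ) * (2 * (h j - 1)) :=
      Finset.sum_le_sum fun j _ => mul_le_mul_of_nonneg_left (hlog j) (Nat.cast_nonneg _)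
    have h4 : ∑ j : Fin n × Fin (q + 1), (a.2 j.1 j.2 : ℝ) * (2 * (h j - 1)) =
        2 * a.1 * ∑ j, ((m j.1 : ℝ) * π j + u j) * (h j - 1) := by
      rw [Finset.mul_sum]
      refine Finset.sum_congr rfl fun j _ => ?_
      rw [count_eq (G := G) (x := x) (m := m) (δ := δ) hN j]
      ring
    rw [h4] at h3
    exact nonneg_of_mul_nonneg_right (h2.trans h3) (by positivity)
  -- Both probability vectors sum to one in each row, so the linear term equals minus half the
  -- squared Hellinger distance.
  have h5 : ∑ j, (m j.1 : ℝ) * π j * (h j - 1) =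
      -(1 / 2) * ∑ j, (m j.1 : ℝ) * (π j * (h j - 1) ^ 2) := by
    have h6 : ∑ j : Fin n × Fin (q + 1), (m j.1 : ℝ) * (π' j - π j) = 0 := by
      rw [Fintype.sum_prod_type]
      refine Finset.sum_eq_zero fun r _ => ?_
      simp only [← Finset.mul_sum, Finset.sum_sub_distrib, hπdef, hπ'def, sum_catProb, sub_self,
        mul_zero]
    rw [Finset.mul_sum, ← sub_eq_zero, ← Finset.sum_sub_distrib]
    rw [← mul_zero (1 / 2 : ℝ), ← h6, Finset.mul_sum]
    refine Finset.sum_congr rfl fun j _ => ?_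
    rw [← hhsq j]
    ring
  have h7 : ∑ j, u j * (h j - 1) ≤ (∑ j, (1 + (π j)⁻¹)) * ‖u‖ := by
    rw [Finset.sum_mul]
    refine Finset.sum_le_sum fun j _ => ?_
    have h8 : |h j - 1| ≤ 1 + (π j)⁻¹ := by
      have h9 : h j ^ 2 ≤ (π j)⁻¹ := by
        have : h j ^ 2 = π' j * (π j)⁻¹ := by
          rw [← hhsq j]; field_simp [(hπ0 j).ne']
        rw [this]
        exact mul_le_of_le_one_left (inv_pos.mpr (hπ0 j)).le (hπ'1 j)
      rw [abs_le]
      constructor <;> nlinarith [hh0 j, inv_pos.mpr (hπ0 j), sq_nonneg (h j - 1)]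
    calc u j * (h j - 1) ≤ |u j| * |h j - 1| := (le_abs_self _).trans (abs_mul _ _).le
      _ ≤ ‖u‖ * (1 + (π j)⁻¹) :=
        mul_le_mul (norm_le_pi_norm u j) h8 (abs_nonneg _) (norm_nonneg _)
      _ = _ := mul_comm _ _
  have h10 : ∑ j, (m j.1 : ℝ) * (π j * (h j - 1) ^ 2) ≤ 2 * ((∑ j, (1 + (π j)⁻¹)) * ‖u‖) := by
    simp only [add_mul, Finset.sum_add_distrib] at h1
    rw [h5] at h1
    simp only [Finset.sum_add_distrib] at h7 ⊢
    linarith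
  have h11 : π i * (h i - 1) ^ 2 ≤ ∑ j, (m j.1 : ℝ) * (π j * (h j - 1) ^ 2) := by
    have h12 : ∀ j, 0 ≤ π j * (h j - 1) ^ 2 := fun j => mul_nonneg (hπ0 j).le (sq_nonneg _)
    refine le_trans ?_ (Finset.single_le_sum (fun j _ => mul_nonneg (Nat.cast_nonneg _) (h12 j))
      (Finset.mem_univ i))
    exact le_mul_of_one_le_left (h12 i) (by exact_mod_cast hm i.1)
  have h13 : (π' i - π i) ^ 2 = π i * (h i - 1) ^ 2 * (π i * (h i + 1) ^ 2) := by
    rw [← hhsq i]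
    ring
  -- `π (h + 1)² = 2π' + 2π - π (h - 1)²`.
  have h14 : π i * (h i + 1) ^ 2 ≤ 4 := by
    have h15 := hhsq i
    nlinarith [hπ1 i, hπ'1 i, mul_nonneg (hπ0 i).le (sq_nonneg (h i - 1))]
  calc (π' i - π i) ^ 2 = π i * (h i - 1) ^ 2 * (π i * (h i + 1) ^ 2) := h13
    _ ≤ π i * (h i - 1) ^ 2 * 4 :=
      mul_le_mul_of_nonneg_left h14 (mul_nonneg (hπ0 i).le (sq_nonneg _))
    _ ≤ _ := by linarith

lemma isEmbedding_cumulative (hG_mono : StrictMono G) (hG : Differentiable ℝ G)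
    (hZ : (fullZ (q := q) x).rank = q + p) :
    IsEmbedding fun (d : Param q p) (i : Fin n × Fin q) => G (eta x d i.1 i.2) := by
  have h1 : IsEmbedding G := hG_mono.isEmbedding_of_ordConnected
    (isPreconnected_range hG.continuous).ordConnected
  have h2 : IsEmbedding (fullZ (q := q) x).mulVecLin :=
    (LinearMap.isClosedEmbedding_of_injective
      (LinearMap.ker_eq_bot.mpr (mulVec_fullZ_injective hZ))).isEmbedding
  exact (IsEmbedding.piMap fun _ : Fin n × Fin q => h1).comp h2

/-- The parameter depends continuously on the cumulative probabilities, by `isEmbedding_cumulative`.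
Each of these sums at most `q + 1` category probabilities, hence the tolerance `c / (q + 1)`. -/
lemma exists_catProb_close (hG_mono : StrictMono G) (hG : Differentiable ℝ G)
    (hZ : (fullZ (q := q) x).rank = q + p) (δ : Param q p) {ε : ℝ} (hε : 0 < ε) :
    ∃ c > 0, ∀ d : Param q p,
      (∀ i : Fin n × Fin (q + 1), |catProb G x d i.1 i.2 - catProb G x δ i.1 i.2| < c) →
        ‖d - δ‖ < ε := by
  have h1 : Metric.ball δ ε ∈ 𝓝 δ := Metric.ball_mem_nhds δ hε
  rw [(isEmbedding_cumulative hG_mono hG hZ).nhds_eq_comap] at h1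
  obtain ⟨U, hU, hUsub⟩ := mem_comap.mp h1
  obtain ⟨c, hc, hcU⟩ := Metric.mem_nhds_iff.mp hU
  refine ⟨c / (q + 1), by positivity, fun d hd => ?_⟩
  rw [← mem_ball_iff_norm]
  refine hUsub (hcU ?_)
  rw [Metric.mem_ball, dist_pi_lt_iff hc]
  rintro ⟨r, s⟩
  have h2 : cumProb G x d r s.succ.castSucc - cumProb G x δ r s.succ.castSucc =
      ∑ s' : Fin (q + 1), if s'.castSucc < s.succ.castSucc then
        catProb G x d r s' - catProb G x δ r s' else 0 := by
    have h3 := sum_filter_sub_castSucc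
      (fun j => cumProb G x d r j - cumProb G x δ r j) s.succ.castSucc
    simp only [show ∀ d : Param q p, cumProb G x d r 0 = 0 from fun _ => rfl, sub_self,
      sub_zero] at h3
    rw [← h3]
    refine Finset.sum_congr rfl fun s' _ => ?_
    split_ifs
    · simp only [catProb]
      ring
    · rfl
  simp only [cumProb, withEnds_mid] at h2
  rw [Real.dist_eq, h2]
  refine (Finset.abs_sum_le_sum_abs _ _).trans_lt ?_
  have hq : (0 : ℝ) < q + 1 := by positivity
  calc ∑ s' : Fin (q + 1), |if s'.castSucc < s.succ.castSucc then
        catProb G x d r s' - catProb G x δ r s' else 0|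
      < ∑ s' : Fin (q + 1), c / (q + 1) := by
        refine Finset.sum_lt_sum_of_nonempty Finset.univ_nonempty fun s' _ => ?_
        split_ifs
        · exact hd (r, s')
        · simpa using div_pos hc hq
    _ = c := by
        rw [Finset.sum_const, Finset.card_univ, Fintype.card_fin, nsmul_eq_mul]
        push_cast
        field_simp

lemma exists_close_of_logLik_le (hG_mono : StrictMono G) (hG_range : ∀ u, G u ∈ Set.Ioo (0 : ℝ) 1)
    (hG : Differentiable ℝ G) (hZ : (fullZ (q := q) x).rank = q + p) (hm : ∀ r, 0 < m r)
    (hδ : δ ∈ paramSpace q p) {ε : ℝ} (hε : 0 < ε) :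
    ∃ ρ > 0, ∀ a ∈ replications q m, ‖meanDeviation G x m δ a‖ < ρ → ∀ d ∈ paramSpace q p,
      logLik G x a.2 δ ≤ logLik G x a.2 d → ‖d - δ‖ < ε := by
  obtain ⟨c, hc, hclose⟩ := exists_catProb_close hG_mono hG hZ δ hε
  have hπ := fun r s => catProb_pos (x := x) hG_mono hG_range hδ r s
  set K := 8 * ∑ j : Fin n × Fin (q + 1), (1 + (catProb G x δ j.1 j.2)⁻¹) with hK
  have hK0 : 0 ≤ K := mul_nonneg (by norm_num) (Finset.sum_nonneg fun j _ =>
    add_nonneg zero_le_one (inv_pos.mpr (hπ j.1 j.2)).le)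
  refine ⟨c ^ 2 / (K + 1), by positivity, fun a ha hρ d hd hle => hclose d fun i => ?_⟩
  have h1 := sq_catProb_sub_le hm hπ
    (fun r s => catProb_pos (x := x) hG_mono hG_range hd r s) ha hle i
  rw [lt_div_iff₀ (by positivity)] at hρ
  refine abs_lt_of_sq_lt_sq (lt_of_le_of_lt h1 ?_) hc.le
  nlinarith [norm_nonneg (meanDeviation G x m δ a)]

/-- Near the expected counts the maximum likelihood estimate exists and is close to `δ`. -/
lemma mle_consistent (hG_mono : StrictMono G) (hG_range : ∀ u, G u ∈ Set.Ioo (0 : ℝ) 1)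
    (hG : Differentiable ℝ G) (hZ : (fullZ (q := q) x).rank = q + p) (hm : ∀ r, 0 < m r)
    (hδ : δ ∈ paramSpace q p) {T : Counts n q → Param q p} (hT : IsMLE G x T)
    {ε : ℝ} (hε : 0 < ε) :
    ∃ ρ > 0, ∀ a ∈ replications q m, ‖meanDeviation G x m δ a‖ < ρ →
      T a.2 ∈ paramSpace q p ∧ IsMaxOn (logLik G x a.2) (paramSpace q p) (T a.2) ∧
        ‖T a.2 - δ‖ < ε := by
  obtain ⟨ε₀, hε₀, hball⟩ :=
    Metric.nhds_basis_closedBall.mem_iff.mp (isOpen_paramSpace.mem_nhds hδ)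
  obtain ⟨ρ, hρ, h⟩ := exists_close_of_logLik_le (x := x) hG_mono hG_range hG hZ hm hδ
    (lt_min hε hε₀)
  refine ⟨ρ, hρ, fun a ha hau => ?_⟩
  have hcont : ContinuousOn (logLik G x a.2) (Metric.closedBall δ ε₀) := fun d hd =>
    (hasFDerivAt_logLik hG_mono hG_range hG (hball hd) a.2).continuousAt.continuousWithinAt
  -- A maximizer over a compact ball is a global one: any point outside the ball is less likely than
  -- the centre `δ`.
  obtain ⟨d, hd, hmax⟩ := (isCompact_closedBall δ ε₀).exists_isMaxOn
    ⟨δ, Metric.mem_closedBall_self hε₀.le⟩ hcont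
  have hδd : logLik G x a.2 δ ≤ logLik G x a.2 d := hmax (Metric.mem_closedBall_self hε₀.le)
  have hd' : IsMaxOn (logLik G x a.2) (paramSpace q p) d := by
    intro d' hd'
    rcases le_total (logLik G x a.2 δ) (logLik G x a.2 d') with h1 | h1
    · refine hmax (mem_closedBall_iff_norm.mpr ?_)
      exact ((h a ha hau d' hd' h1).trans_le (min_le_right _ _)).le
    · exact h1.trans hδd
  obtain ⟨h1, h2⟩ := hT a.2 ⟨d, hball hd, hd'⟩
  exact ⟨h1, h2, (h a ha hau _ h1 (h2 hδ)).trans_le (min_le_left _ _)⟩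

variable (G x) in
/-- The derivatives `∂² log π_{rs} / ∂δ_t ∂δ_t'`. -/
def logHess (δ : Param q p) (i : Fin n × Fin (q + 1)) (t t' : Fin q ⊕ Fin p) : ℝ :=
  fderiv ℝ (fun d => logGrad G x d i t) δ (Pi.single t' 1)

/-- The second-order expansion of the maximum likelihood estimator. -/
lemma mle_expansion (hG_mono : StrictMono G) (hG_range : ∀ u, G u ∈ Set.Ioo (0 : ℝ) 1)
    (hG : Differentiable ℝ G) (hG' : Differentiable ℝ (deriv G))
    (hZ : (fullZ (q := q) x).rank = q + p) (hm : ∀ r, 0 < m r)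
    (hδ : δ ∈ paramSpace q p) (hF : IsUnit (information G x m δ))
    {T : Counts n q → Param q p} (hT : IsMLE G x T) :
    (fun a => T a.2 - δ -
      rootLinear (information G x m δ)⁻¹ (logGrad G x δ) (meanDeviation G x m δ a) -
        (information G x m δ)⁻¹ *ᵥ equationQuadratic (meanGrad G x m δ)
          (fun i => (m i.1 : ℝ) • catHess G x δ i) (logGrad G x δ) (logHess G x δ)
          (meanDeviation G x m δ a)
          (rootLinear (information G x m δ)⁻¹ (logGrad G x δ) (meanDeviation G x m δ a)))
      =o[comap (meanDeviation G x m δ) (𝓝 0) ⊓ 𝓟 (replications q m)]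
        fun a => ‖meanDeviation G x m δ a‖ ^ 2 := by
  -- The filter makes the deviation small without sending `N` to infinity, so the expansion is
  -- deterministic and uniform in `N`.
  have hcons : ∀ ε > 0, ∀ᶠ a in comap (meanDeviation G x m δ) (𝓝 0) ⊓ 𝓟 (replications q m),
      a ∈ replications q m ∧ T a.2 ∈ paramSpace q p ∧
        IsMaxOn (logLik G x a.2) (paramSpace q p) (T a.2) ∧ ‖T a.2 - δ‖ < ε := by
    intro ε hε
    obtain ⟨ρ, hρ, h⟩ := mle_consistent hG_mono hG_range hG hZ hm hδ hT hε
    rw [eventually_inf_principal]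
    filter_upwards [preimage_mem_comap (Metric.ball_mem_nhds 0 hρ)] with a ha har
    exact ⟨har, h a har (by simpa using ha)⟩
  have hπ := fun r s => (catProb_pos (x := x) hG_mono hG_range hδ r s).ne'
  refine root_expansion (v := fun a : ℕ × Counts n q => T a.2 - δ)
    (μ := fun w i => (m i.1 : ℝ) * (catProb G x (δ + w) i.1 i.2 - catProb G x δ i.1 i.2))
    (Φ := fun w i t => logGrad G x (δ + w) i t) ?_ (fun i => ?_) (fun i t => ?_) ?_ ?_
  · rw [Metric.tendsto_nhds]
    intro ε hε
    filter_upwards [hcons ε hε] with a ha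
    simpa using ha.2.2.2
  · refine ((isLittleO_catProb (x := x) hG hG' δ i).const_mul_left
      (m i.1 : ℝ)).congr_left fun w => ?_
    have h1 : (meanGrad G x m δ *ᵥ w) i = m i.1 * (catGrad G x δ *ᵥ w) i := by
      simp only [mulVec, dotProduct, meanGrad, of_apply, Finset.mul_sum, mul_assoc]
    rw [h1, smul_mulVec, dotProduct_smul, smul_eq_mul]
    ring
  · exact isLittleO_logGrad hG hG' (hπ i.1 i.2) t
  · filter_upwards [hcons 1 one_pos] with a ⟨har, hmem, hmax, _⟩ t
    have h1 : score G x a.2 (T a.2) t = 0 := by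
      rw [score, (hmax.isLocalMax (isOpen_paramSpace.mem_nhds hmem)).fderiv_eq_zero]
      rfl
    -- The score is centered at the estimate itself; `count_eq` then recenters the counts at `δ`,
    -- and the common factor `N` cancels.
    rw [score_eq_centered (m := fun r => a.1 * m r) hG_mono hG_range hG hmem] at h1
    have hN : (a.1 : ℝ) ≠ 0 := by exact_mod_cast har.1.ne'
    have h2 : (a.1 : ℝ) * ∑ i, (meanDeviation G x m δ a i - (m i.1 : ℝ) *
        (catProb G x (δ + (T a.2 - δ)) i.1 i.2 - catProb G x δ i.1 i.2)) *
          logGrad G x (δ + (T a.2 - δ)) i t = 0 := by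
      rw [← h1, Finset.mul_sum]
      refine Finset.sum_congr rfl fun i _ => ?_
      rw [add_sub_cancel, centered, count_eq (G := G) (x := x) (m := m) (δ := δ) har.1 i]
      push_cast
      ring
    exact (mul_eq_zero.mp h2).resolve_left hN
  · rw [← information_eq hG_mono hG_range hG hδ]
    exact Matrix.nonsing_inv_mul _ ((Matrix.isUnit_iff_isUnit_det _).mp hF)

end Consistency


/-! ### Expectation of the expansion and the first-order bias -/

section Bias

open Asymptotics Matrix

variable {n p q : ℕ} {G : ℝ → ℝ} {x : Fin n → Fin p → ℝ} {m : Fin n → ℕ} {δ : Param q p}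

lemma norm_pow_le_sum {ι : Type*} [Fintype ι] (u : ι → ℝ) {k : ℕ} (hk : k ≠ 0) :
    ‖u‖ ^ k ≤ ∑ i, |u i| ^ k := by
  rcases isEmpty_or_nonempty ι with hι | hι
  · simp [Subsingleton.elim u 0, hk]
  · obtain ⟨i, hi⟩ := Finite.exists_max fun i => |u i|
    have h1 : ‖u‖ ≤ |u i| := (pi_norm_le_iff_of_nonneg (abs_nonneg _)).mpr hi
    exact (pow_le_pow_left₀ (norm_nonneg _) h1 k).trans
      (Finset.single_le_sum (f := fun i => |u i| ^ k) (fun j _ => pow_nonneg (abs_nonneg _) k)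
        (Finset.mem_univ i))

lemma norm_rootLinear_le {ι κ : Type*} [Fintype ι] [Fintype κ] (S : Matrix κ κ ℝ)
    (D : Matrix ι κ ℝ) : ∃ C, ∀ u, ‖rootLinear S D u‖ ≤ C * ‖u‖ :=
  isBigO_top.mp ((isBigO_mulVec (l := ⊤) S _).trans (isBigO_mulVec Dᵀ fun u => u))

/-- The big-O relations are taken along `⊤`, so the bound holds for every `u`; it is needed for data
far from their mean. -/
lemma norm_equationQuadratic_le {ι κ : Type*} [Fintype ι] [Fintype κ] (S : Matrix κ κ ℝ)
    (J D : Matrix ι κ ℝ) (H : ι → Matrix κ κ ℝ) (D' : ι → κ → κ → ℝ) :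
    ∃ C, ∀ u, ‖S *ᵥ equationQuadratic J H D D' u (rootLinear S D u)‖ ≤ C * ‖u‖ ^ 2 := by
  have hw : (fun u => rootLinear S D u) =O[⊤] fun u : ι → ℝ => u :=
    (isBigO_mulVec (l := ⊤) S _).trans (isBigO_mulVec Dᵀ fun u => u)
  have hmul : ∀ {f g : (ι → ℝ) → ℝ}, f =O[⊤] (fun u : ι → ℝ => u) →
      g =O[⊤] (fun u : ι → ℝ => u) → (fun u => f u * g u) =O[⊤] fun u => ‖u‖ ^ 2 := by
    intro f g hf hg
    simp only [pow_two]
    exact hf.norm_right.mul hg.norm_right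
  have h : (fun u => S *ᵥ equationQuadratic J H D D' u (rootLinear S D u)) =O[⊤]
      fun u => ‖u‖ ^ 2 := by
    refine (isBigO_mulVec S _).trans (isBigO_pi.mpr fun t => ?_)
    refine isBigO_sum_univ fun i => IsBigO.add ?_ (hmul ?_ ?_)
    · have h1 : (fun u => rootLinear S D u ⬝ᵥ (H i *ᵥ rootLinear S D u)) =O[⊤]
          fun u => ‖u‖ ^ 2 :=
        isBigO_sum_univ fun t => hmul ((isBigO_apply _ t).trans hw)
          ((isBigO_mulVec_apply (H i) _ t).trans hw)
      exact (h1.const_mul_left (-(1 / 2) * D i t)).congr_left fun u => by ring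
    · exact (isBigO_apply (fun u => u) i).sub ((isBigO_mulVec_apply J _ i).trans hw)
    · exact (isBigO_dotProduct_const _ _).trans hw
  obtain ⟨C, hC⟩ := isBigO_top.mp h
  exact ⟨C, fun u => by simpa using hC u⟩

lemma expectation_meanDeviation (N : ℕ) (i : Fin n × Fin (q + 1)) :
    expectation G x (fun r => N * m r) δ (fun y => meanDeviation G x m δ (N, y) i) = 0 := by
  simp only [meanDeviation, expectation_const_mul, expectation_centered, mul_zero]

lemma expectation_meanDeviation_mul {N : ℕ} (hN : 0 < N) (i j : Fin n × Fin (q + 1)) :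
    (N : ℝ) * expectation G x (fun r => N * m r) δ
      (fun y => meanDeviation G x m δ (N, y) i * meanDeviation G x m δ (N, y) j) =
        covariance G x m δ i j := by
  have hN' : (N : ℝ) ≠ 0 := by positivity
  simp only [meanDeviation, mul_mul_mul_comm, expectation_const_mul, expectation_centered_mul,
    covariance, of_apply]
  split_ifs
  · push_cast
    field_simp
  · push_cast
    field_simp
  · simp

lemma expectation_meanDeviation_pow_four_le (hπ : ∀ r s, 0 < catProb G x δ r s) {N : ℕ}
    (hN : 0 < N) (i : Fin n × Fin (q + 1)) :
    (N : ℝ) * expectation G x (fun r => N * m r) δ (fun y => meanDeviation G x m δ (N, y) i ^ 4) ≤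
      3 * (m i.1 : ℝ) ^ 2 / N := by
  have hN' : (0 : ℝ) < N := by exact_mod_cast hN
  have h := expectation_centered_pow_four_le (m := fun r => N * m r) (fun r s => (hπ r s).le) i
  simp only [meanDeviation, mul_pow, expectation_const_mul]
  calc _ ≤ (N : ℝ) * ((N : ℝ)⁻¹ ^ 4 * (3 * ((N * m i.1 : ℕ) : ℝ) ^ 2)) := by gcongr
    _ = _ := by push_cast; field_simp

lemma expectation_linear {κ : Type*} (A : Matrix κ (Fin n × Fin (q + 1)) ℝ) (N : ℕ) (t : κ) :
    expectation G x (fun r => N * m r) δ (fun y => (A *ᵥ meanDeviation G x m δ (N, y)) t) = 0 := by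
  simp only [mulVec, dotProduct, expectation_sum, expectation_const_mul,
    expectation_meanDeviation, mul_zero, Finset.sum_const_zero]

lemma expectation_linear_mul_linear {κ κ' : Type*} (A : Matrix κ (Fin n × Fin (q + 1)) ℝ)
    (B : Matrix κ' (Fin n × Fin (q + 1)) ℝ) {N : ℕ} (hN : 0 < N) (t : κ) (t' : κ') :
    (N : ℝ) * expectation G x (fun r => N * m r) δ
      (fun y => (A *ᵥ meanDeviation G x m δ (N, y)) t * (B *ᵥ meanDeviation G x m δ (N, y)) t') =
        (A * covariance G x m δ * Bᵀ) t t' := by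
  have h : ∀ i j (y : Counts n q), A t i * meanDeviation G x m δ (N, y) i *
      (B t' j * meanDeviation G x m δ (N, y) j) = A t i * B t' j *
        (meanDeviation G x m δ (N, y) i * meanDeviation G x m δ (N, y) j) :=
    fun i j y => by ring
  simp only [mulVec, dotProduct, Finset.sum_mul_sum, expectation_sum, h, expectation_const_mul]
  simp only [mul_apply, transpose_apply, Finset.mul_sum, Finset.sum_mul]
  rw [Finset.sum_comm]
  refine Finset.sum_congr rfl fun j _ => Finset.sum_congr rfl fun i _ => ?_
  rw [← expectation_meanDeviation_mul hN i j]
  ring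

lemma abs_expectation_le (hπ : ∀ r s, 0 < catProb G x δ r s) {f g : Counts n q → ℝ}
    (h : ∀ y ∈ sampleSpace q m, |f y| ≤ g y) :
    |expectation G x m δ f| ≤ expectation G x m δ g := by
  refine (Finset.abs_sum_le_sum_abs _ _).trans (Finset.sum_le_sum fun y hy => ?_)
  rw [smul_eq_mul, abs_mul, abs_of_pos (likelihood_pos hπ y)]
  exact mul_le_mul_of_nonneg_left (h y hy) (likelihood_pos hπ y).le

variable (G x m δ) in
/-- The increments `c_{rs} - c_{r,s-1}` of the adjustments to the counts. -/
def countAdjDiff (r : Fin n) (s : Fin (q + 1)) : ℝ :=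
  countAdj G x m δ r s.succ - countAdj G x m δ r s.castSucc

/-- `N` times the expected quadratic term of the score equations. -/
lemma expectation_equationQuadratic (hG_mono : StrictMono G)
    (hG_range : ∀ u, G u ∈ Set.Ioo (0 : ℝ) 1) (hG : Differentiable ℝ G)
    (hδ : δ ∈ paramSpace q p) (hF : IsUnit (information G x m δ)) {N : ℕ} (hN : 0 < N)
    (t : Fin q ⊕ Fin p) :
    (N : ℝ) * expectation G x (fun r => N * m r) δ (fun y =>
      equationQuadratic (meanGrad G x m δ) (fun i => (m i.1 : ℝ) • catHess G x δ i)
        (logGrad G x δ) (logHess G x δ) (meanDeviation G x m δ (N, y))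
        (rootLinear (information G x m δ)⁻¹ (logGrad G x δ) (meanDeviation G x m δ (N, y))) t) =
      -scoreForm G x (countAdjDiff G x m δ) δ t := by
  have hdet := (Matrix.isUnit_iff_isUnit_det _).mp hF
  have hC := covariance_mul_logGrad (m := m)
    fun r s => (catProb_pos (x := x) hG_mono hG_range hδ r s).ne'
  have hFeq := information_eq (x := x) (m := m) hG_mono hG_range hG hδ
  have hsymm : ((information G x m δ)⁻¹)ᵀ = (information G x m δ)⁻¹ := by
    rw [transpose_nonsing_inv, isSymm_information.eq]
  set F := information G x m δ with hFdef
  set D := logGrad G x δ with hD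
  set J := meanGrad G x m δ with hJ
  set K := F⁻¹ * Dᵀ with hK
  have hKT : covariance G x m δ * Kᵀ = J * F⁻¹ := by
    rw [hK, transpose_mul, transpose_transpose, ← Matrix.mul_assoc, hC, hsymm]
  have hKJ : K * J = 1 := by
    rw [hK, Matrix.mul_assoc, ← hFeq, Matrix.nonsing_inv_mul _ hdet]
  have hvar : K * covariance G x m δ * Kᵀ = F⁻¹ := by
    rw [Matrix.mul_assoc, hKT, ← Matrix.mul_assoc, hKJ, Matrix.one_mul]
  -- The residual `u - J w` is uncorrelated with `w`, which eliminates `logHess` from the mean.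
  have hcov : (1 - J * K) * covariance G x m δ * Kᵀ = 0 := by
    rw [Matrix.mul_assoc, hKT, Matrix.sub_mul, Matrix.one_mul, Matrix.mul_assoc J K,
      ← Matrix.mul_assoc K, hKJ, Matrix.one_mul, sub_self]
  have hterm : ∀ y : Counts n q, equationQuadratic J (fun i => (m i.1 : ℝ) • catHess G x δ i)
      D (logHess G x δ) (meanDeviation G x m δ (N, y))
      (rootLinear F⁻¹ D (meanDeviation G x m δ (N, y))) t =
      ∑ i, (∑ k, ∑ k', (-(1 / 2) * m i.1 * catHess G x δ i k k' * D i t) *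
          ((K *ᵥ meanDeviation G x m δ (N, y)) k * (K *ᵥ meanDeviation G x m δ (N, y)) k') +
        ∑ k, logHess G x δ i t k * (((1 - J * K) *ᵥ meanDeviation G x m δ (N, y)) i *
          (K *ᵥ meanDeviation G x m δ (N, y)) k)) := by
    intro y
    generalize meanDeviation G x m δ (N, y) = u
    have hw : rootLinear F⁻¹ D u = K *ᵥ u := by rw [rootLinear, mulVec_mulVec]
    have hr : u - J *ᵥ (K *ᵥ u) = (1 - J * K) *ᵥ u := by
      rw [sub_mulVec, one_mulVec, mulVec_mulVec]
    rw [equationQuadratic, hw, hr]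
    generalize K *ᵥ u = w
    generalize (1 - J * K) *ᵥ u = z
    refine Finset.sum_congr rfl fun i _ => ?_
    congr 1
    · simp only [dotProduct, mulVec, Finset.mul_sum, Finset.sum_mul, Matrix.smul_apply,
        smul_eq_mul]
      exact Finset.sum_congr rfl fun _ _ => Finset.sum_congr rfl fun _ _ => by ring
    · simp only [dotProduct, Finset.mul_sum]
      exact Finset.sum_congr rfl fun _ _ => by ring
  simp only [hterm, expectation_sum, expectation_add, expectation_const_mul]
  have h1 : ∀ (c : ℝ) k k', (N : ℝ) * (c * expectation G x (fun r => N * m r) δ fun y =>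
      (K *ᵥ meanDeviation G x m δ (N, y)) k * (K *ᵥ meanDeviation G x m δ (N, y)) k') =
        c * F⁻¹ k k' := by
    intro c k k'
    rw [mul_left_comm, expectation_linear_mul_linear K K hN, hvar]
  have h2 : ∀ (c : ℝ) i k, (N : ℝ) * (c * expectation G x (fun r => N * m r) δ fun y =>
      ((1 - J * K) *ᵥ meanDeviation G x m δ (N, y)) i *
        (K *ᵥ meanDeviation G x m δ (N, y)) k) = 0 := by
    intro c i k
    rw [mul_left_comm, expectation_linear_mul_linear (1 - J * K) K hN, hcov]
    simp
  simp only [Finset.mul_sum, mul_add, h1, h2, Finset.sum_const_zero, add_zero]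
  rw [scoreForm_eq, ← Finset.sum_neg_distrib]
  refine Finset.sum_congr rfl fun i _ => ?_
  rw [countAdjDiff, ← half_sum_catHess_mul, ← hFdef, ← hD]
  simp only [Finset.mul_sum, Finset.sum_mul, ← Finset.sum_neg_distrib]
  exact Finset.sum_congr rfl fun _ _ => Finset.sum_congr rfl fun _ _ => by ring

lemma tendsto_of_abs_sub_le {f : ℕ → ℝ} {b V : ℝ} (hV : 0 ≤ V)
    (h : ∀ c > 0, ∃ B, ∀ N : ℕ, 0 < N → |f N - b| ≤ c * V + B / N) :
    Tendsto f atTop (𝓝 b) := by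
  rw [Metric.tendsto_nhds]
  intro ε hε
  obtain ⟨B, hB⟩ := h (ε / (2 * (V + 1))) (by positivity)
  have h1 := (tendsto_const_div_atTop_nhds_zero_nat B).eventually_lt_const (half_pos hε)
  filter_upwards [h1, eventually_gt_atTop 0] with N hN hN0
  rw [Real.dist_eq]
  refine (hB N hN0).trans_lt ?_
  have h2 : ε / (2 * (V + 1)) * V ≤ ε / 2 := by
    rw [div_mul_eq_mul_div, div_le_div_iff₀ (by positivity) two_pos]
    nlinarith
  linarith

/-- The error of the expansion of the truncated estimation error, controlled for all data. -/
lemma abs_remainder_le {ι κ α : Type*} [Fintype ι] [Fintype κ] {A : Set α} {u : α → ι → ℝ}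
    {v L Q : α → κ → ℝ} {ε C₁ C₂ : ℝ} (hε : 0 < ε)
    (hcons : ∃ ρ > 0, ∀ a ∈ A, ‖u a‖ < ρ → ‖v a‖ < ε)
    (hexp : (fun a => v a - L a - Q a) =o[comap u (𝓝 0) ⊓ 𝓟 A] fun a => ‖u a‖ ^ 2)
    (hL : ∀ a, ‖L a‖ ≤ C₁ * ‖u a‖) (hQ : ∀ a, ‖Q a‖ ≤ C₂ * ‖u a‖ ^ 2) {c : ℝ} (hc : 0 < c) :
    ∃ B, ∀ a ∈ A, ‖(if ‖v a‖ ≤ ε then v a else 0) - L a - Q a‖ ≤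
      ∑ i, (c * (u a i * u a i) + B * u a i ^ 4) := by
  obtain ⟨ρ₁, hρ₁, h₁⟩ := hcons
  have h2 := isLittleO_iff.mp hexp hc
  rw [eventually_inf_principal] at h2
  obtain ⟨U, hU, hUsub⟩ := mem_comap.mp h2
  obtain ⟨ρ₂, hρ₂, hU2⟩ := Metric.mem_nhds_iff.mp hU
  set ρ := min ρ₁ ρ₂ with hρ
  have hρ0 : 0 < ρ := lt_min hρ₁ hρ₂
  -- For `‖u‖ ≥ ρ`, the truncated error and the linear and quadratic terms are each dominated by a
  -- multiple of `‖u‖⁴`; the summands are these multiples.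
  set B := ε / ρ ^ 4 + |C₁| / ρ ^ 3 + |C₂| / ρ ^ 2 with hB
  have hB0 : 0 ≤ B := by positivity
  refine ⟨B, fun a ha => ?_⟩
  have hsq : ‖u a‖ ^ 2 ≤ ∑ i, u a i * u a i := by
    simpa [pow_two] using norm_pow_le_sum (u a) two_ne_zero
  have hfour : ‖u a‖ ^ 4 ≤ ∑ i, u a i ^ 4 := by
    simpa [Even.pow_abs (show Even 4 by decide)] using norm_pow_le_sum (u a) four_ne_zero
  rw [Finset.sum_add_distrib, ← Finset.mul_sum, ← Finset.mul_sum]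
  refine le_trans ?_ (add_le_add (mul_le_mul_of_nonneg_left hsq hc.le)
    (mul_le_mul_of_nonneg_left hfour hB0))
  rcases lt_or_ge ‖u a‖ ρ with hu | hu
  -- For small deviations the truncation is inactive and the expansion applies.
  · rw [if_pos (h₁ a ha (hu.trans_le (min_le_left _ _))).le]
    have h3 : ‖v a - L a - Q a‖ ≤ c * ‖‖u a‖ ^ 2‖ :=
      hUsub (hU2 (mem_ball_zero_iff.mpr (hu.trans_le (min_le_right _ _)))) ha
    rw [Real.norm_of_nonneg (by positivity)] at h3
    exact h3.trans (le_add_of_nonneg_right (by positivity))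
  · have h4 : ‖if ‖v a‖ ≤ ε then v a else 0‖ ≤ ε := by
      split_ifs with h
      · exact h
      · simpa using hε.le
    have h5 : ‖(if ‖v a‖ ≤ ε then v a else 0) - L a - Q a‖ ≤
        ε + |C₁| * ‖u a‖ + |C₂| * ‖u a‖ ^ 2 := by
      refine (norm_sub_le _ _).trans (add_le_add ((norm_sub_le _ _).trans (add_le_add h4 ?_)) ?_)
      · exact (hL a).trans (mul_le_mul_of_nonneg_right (le_abs_self _) (norm_nonneg _))
      · exact (hQ a).trans (mul_le_mul_of_nonneg_right (le_abs_self _) (by positivity))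
    have h6 : ε ≤ ε / ρ ^ 4 * ‖u a‖ ^ 4 := by
      rw [div_mul_eq_mul_div, le_div_iff₀ (by positivity)]
      gcongr
    have h7 : |C₁| * ‖u a‖ ≤ |C₁| / ρ ^ 3 * ‖u a‖ ^ 4 := by
      rw [div_mul_eq_mul_div, le_div_iff₀ (by positivity), mul_assoc]
      gcongr
      rw [pow_succ' _ 3]
      gcongr
    have h8 : |C₂| * ‖u a‖ ^ 2 ≤ |C₂| / ρ ^ 2 * ‖u a‖ ^ 4 := by
      rw [div_mul_eq_mul_div, le_div_iff₀ (by positivity), mul_assoc]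
      gcongr
      rw [show ‖u a‖ ^ 4 = ‖u a‖ ^ 2 * ‖u a‖ ^ 2 by ring]
      gcongr
    have h9 : 0 ≤ c * ‖u a‖ ^ 2 := by positivity
    rw [hB, add_mul, add_mul]
    linarith

/-- The first-order bias of the maximum likelihood estimator. -/
theorem isFirstOrderBias (hG_mono : StrictMono G) (hG_range : ∀ u, G u ∈ Set.Ioo (0 : ℝ) 1)
    (hG : Differentiable ℝ G) (hG' : Differentiable ℝ (deriv G))
    (hZ : (fullZ (q := q) x).rank = q + p) (hm : ∀ r, 0 < m r)
    (hδ : δ ∈ paramSpace q p) (hF : IsUnit (information G x m δ)) :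
    IsFirstOrderBias G x m δ
      (-((information G x m δ)⁻¹ *ᵥ scoreForm G x (countAdjDiff G x m δ) δ)) := by
  intro T hT ε hε
  have hπ := fun r s => catProb_pos (x := x) hG_mono hG_range hδ r s
  rw [tendsto_pi_nhds]
  intro t
  set S := (information G x m δ)⁻¹ with hS
  set L : ℕ × Counts n q → Param q p := fun a =>
    rootLinear S (logGrad G x δ) (meanDeviation G x m δ a) with hL
  set Q : ℕ × Counts n q → Param q p := fun a =>
    S *ᵥ equationQuadratic (meanGrad G x m δ) (fun i => (m i.1 : ℝ) • catHess G x δ i)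
      (logGrad G x δ) (logHess G x δ) (meanDeviation G x m δ a) (L a) with hQ
  obtain ⟨C₁, hC₁⟩ := norm_rootLinear_le S (logGrad G x δ)
  obtain ⟨C₂, hC₂⟩ := norm_equationQuadratic_le S (meanGrad G x m δ) (logGrad G x δ)
    (fun i => (m i.1 : ℝ) • catHess G x δ i) (logHess G x δ)
  have hcons : ∃ ρ > 0, ∀ a ∈ replications q m, ‖meanDeviation G x m δ a‖ < ρ →
      ‖T a.2 - δ‖ < ε := by
    obtain ⟨ρ, hρ, h⟩ := mle_consistent hG_mono hG_range hG hZ hm hδ hT hε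
    exact ⟨ρ, hρ, fun a ha hu => (h a ha hu).2.2⟩
  have hV : 0 ≤ ∑ i, covariance G x m δ i i := by
    refine Finset.sum_nonneg fun i _ => ?_
    have h1 := catProb_le_one hπ i.1 i.2
    have h2 := hπ i.1 i.2
    simp only [covariance, of_apply, if_true]
    exact mul_nonneg (Nat.cast_nonneg _) (by nlinarith)
  refine tendsto_of_abs_sub_le hV fun c hc => ?_
  obtain ⟨B, hB⟩ := abs_remainder_le (v := fun a : ℕ × Counts n q => T a.2 - δ) (L := L) (Q := Q)
    hε hcons (mle_expansion hG_mono hG_range hG hG' hZ hm hδ hF hT)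
    (fun a => hC₁ _) (fun a => hC₂ _) hc
  -- The second moments contribute `c` times the trace of the covariance, the fourth moments the `1
  -- / N` term; `|B|` is used because the sign of `B` is not recorded.
  refine ⟨|B| * ∑ i : Fin n × Fin (q + 1), 3 * (m i.1 : ℝ) ^ 2, fun N hN => ?_⟩
  have hN' : (0 : ℝ) < N := by exact_mod_cast hN
  have hELin : expectation G x (fun r => N * m r) δ (fun y => L (N, y) t) = 0 := by
    simp only [hL, rootLinear, mulVec_mulVec]
    exact expectation_linear _ N t
  have hEQuad : (N : ℝ) * expectation G x (fun r => N * m r) δ (fun y => Q (N, y) t) =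
      (-(S *ᵥ scoreForm G x (countAdjDiff G x m δ) δ)) t := by
    simp only [hQ, mulVec, dotProduct, expectation_sum, expectation_const_mul, Finset.mul_sum,
      Pi.neg_apply, ← Finset.sum_neg_distrib]
    refine Finset.sum_congr rfl fun k _ => ?_
    rw [mul_left_comm, expectation_equationQuadratic hG_mono hG_range hG hδ hF hN, mul_neg]
  have hsplit : ((N : ℝ) • expectation G x (fun r => N * m r) δ fun y =>
      if ‖T y - δ‖ ≤ ε then T y - δ else 0) t - (-(S *ᵥ scoreForm G x (countAdjDiff G x m δ) δ)) t =
      N * expectation G x (fun r => N * m r) δ fun y =>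
        ((if ‖T y - δ‖ ≤ ε then T y - δ else 0) - L (N, y) - Q (N, y)) t := by
    have h1 : ∀ y : Counts n q, (if ‖T y - δ‖ ≤ ε then T y - δ else 0) t =
        ((if ‖T y - δ‖ ≤ ε then T y - δ else 0) - L (N, y) - Q (N, y)) t +
          (L (N, y) t + Q (N, y) t) := fun y => by
      simp only [Pi.sub_apply]
      ring
    rw [Pi.smul_apply, smul_eq_mul, expectation_apply]
    simp only [h1]
    rw [expectation_add, expectation_add, hELin, mul_add, zero_add, hEQuad]
    ring
  rw [hsplit, abs_mul, abs_of_pos hN']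
  have hbound := abs_expectation_le (m := fun r => N * m r) hπ
    (f := fun y => ((if ‖T y - δ‖ ≤ ε then T y - δ else 0) - L (N, y) - Q (N, y)) t)
    (g := fun y => ∑ i, (c * (meanDeviation G x m δ (N, y) i * meanDeviation G x m δ (N, y) i) +
      B * meanDeviation G x m δ (N, y) i ^ 4))
    fun y hy => (norm_le_pi_norm _ t).trans (hB (N, y) ⟨hN, hy⟩)
  refine (mul_le_mul_of_nonneg_left hbound hN'.le).trans ?_
  simp only [expectation_sum, expectation_add, expectation_const_mul]
  rw [Finset.sum_add_distrib, mul_add, Finset.mul_sum, Finset.mul_sum, Finset.mul_sum,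
    mul_div_assoc, Finset.sum_div, Finset.mul_sum]
  refine add_le_add (Finset.sum_le_sum fun i _ => ?_) (Finset.sum_le_sum fun i _ => ?_)
  · rw [mul_left_comm, expectation_meanDeviation_mul hN]
  · have h1 := expectation_meanDeviation_pow_four_le (m := m) hπ hN i
    have h2 : 0 ≤ expectation G x (fun r => N * m r) δ
        fun y => meanDeviation G x m δ (N, y) i ^ 4 :=
      Finset.sum_nonneg fun y _ => mul_nonneg (likelihood_pos hπ y).le (by positivity)
    calc _ = B * (N * expectation G x (fun r => N * m r) δ
          fun y => meanDeviation G x m δ (N, y) i ^ 4) := mul_left_comm _ _ _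
      _ ≤ |B| * (N * expectation G x (fun r => N * m r) δ
          fun y => meanDeviation G x m δ (N, y) i ^ 4) :=
        mul_le_mul_of_nonneg_right (le_abs_self B) (mul_nonneg hN'.le h2)
      _ ≤ _ := mul_le_mul_of_nonneg_left h1 (abs_nonneg B)

variable (G x) in
-- The bias condition quantifies over all estimators, so it determines `b` only if one exists. The
-- value `0` serves where no maximizer exists.
lemma exists_isMLE : ∃ T : Counts n q → Param q p, IsMLE G x T := by
  classical
  refine ⟨fun y => if h : ∃ d ∈ paramSpace q p, IsMaxOn (logLik G x y) (paramSpace q p) d then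
    h.choose else 0, fun y h => ?_⟩
  simp only [dif_pos h]
  exact h.choose_spec

lemma IsFirstOrderBias.unique {b b' : Param q p} (h : IsFirstOrderBias G x m δ b)
    (h' : IsFirstOrderBias G x m δ b') : b = b' := by
  obtain ⟨T, hT⟩ := exists_isMLE (q := q) G x
  exact tendsto_nhds_unique (h T hT 1 one_pos) (h' T hT 1 one_pos)

end Bias

end
end CumulativeLink

/-! ### The adjusted scores -/

open CumulativeLink
theorem mainTheorem1 (n p q : ℕ) (G : ℝ → ℝ)
    (hG_mono : StrictMono G) (hG_range : ∀ u, G u ∈ Set.Ioo (0 : ℝ) 1)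
    (hG_diff : Differentiable ℝ G) (hG_diff2 : Differentiable ℝ (deriv G))
    (x : Fin n → Fin p → ℝ) (hZ : (fullZ (q := q) x).rank = q + p)
    (m : Fin n → ℕ) (hm : ∀ r, 0 < m r)
    (δ : Param q p) (hδ : δ ∈ paramSpace q p) :
    -- the information matrix is invertible as soon as no `g(η_{rs})` vanishes
    ((∀ r s, deriv G (eta x δ r s) ≠ 0) → IsUnit (information G x m δ)) ∧
    (IsUnit (information G x m δ) →
      -- the first-order bias exists and is unique
      (∃! b, IsFirstOrderBias G x m δ b) ∧
      ∀ b, IsFirstOrderBias G x m δ b →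
        -- closed form of the adjustment functions
        (∀ t, adjustment G x m δ b t =
          scoreForm G x (fun r s => countAdj G x m δ r s.succ - countAdj G x m δ r s.castSucc) δ t) ∧
        ∀ y : Counts n q, (∀ r, ∑ s, y r s = m r) →
          -- the ordinary scores
          DifferentiableAt ℝ (logLik G x y) δ ∧
          (∀ t, score G x y δ t = scoreForm G x (fun r s => (y r s : ℝ)) δ t) ∧
          -- the adjusted scores
          (∀ t, score G x y δ t + adjustment G x m δ b t =
            scoreForm G x
              (fun r s => (y r s : ℝ) + countAdj G x m δ r s.succ - countAdj G x m δ r s.castSucc) δ t)) := by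
  refine ⟨isUnit_information hG_mono hG_range hG_diff hδ hm hZ, fun hF => ?_⟩
  have hbias := isFirstOrderBias hG_mono hG_range hG_diff hG_diff2 hZ hm hδ hF
  refine ⟨⟨_, hbias, fun b hb => hb.unique hbias⟩, fun b hb => ?_⟩
  have hadj : ∀ t, adjustment G x m δ b t = scoreForm G x
      (fun r s => countAdj G x m δ r s.succ - countAdj G x m δ r s.castSucc) δ t := by
    intro t
    -- By uniqueness `b` is the computed bias, and `-F` cancels its factor `-F⁻¹`.
    rw [hb.unique hbias, adjustment, Matrix.mulVec_neg, neg_neg, Matrix.mulVec_mulVec,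
      Matrix.mul_nonsing_inv _ ((Matrix.isUnit_iff_isUnit_det _).mp hF), Matrix.one_mulVec]
    rfl
  refine ⟨hadj, fun y _ => ⟨(hasFDerivAt_logLik hG_mono hG_range hG_diff hδ y).differentiableAt,
    fun t => ?_, fun t => ?_⟩⟩
  · rw [score_eq hG_mono hG_range hG_diff hδ, scoreForm_eq]
  · rw [hadj, score_eq hG_mono hG_range hG_diff hδ, scoreForm_eq, scoreForm_eq,
      ← Finset.sum_add_distrib]
    exact Finset.sum_congr rfl fun i _ => by ring
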